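/- Let $\{n(j)\}_{j}$ be a sequence of integers $n(j)\ge 2$ with $n(j)\to\infty$, let $a_{ij}>0$ for $1\le i\le n(j)$, and let $\{a_i\}_{i\ge 1}$ be a sequence of nonnegative reals with $\sum_i a_i^2<\infty$. Assume $$\lim_{j\to\infty}\sum_{i=1}^{n(j)}(a_{ij}-a_i)^2=0 .$$ Notation. For $\alpha_1,\dots,\alpha_n>0$ let $\mathcal E^n_{\{\alpha_i\}}=\{x\in\mathbb R^n:\sum_i x_i^2/\alpha_i^2\le 1\}$, with the normalized Lebesgue measure $\epsilon^n_{\{\alpha_i\}}$, and let $\mathcal S^{n-1}_{\{\alpha_i\}}=\{x\in\mathbb R^n:\sum_i x_i^2/\alpha_i^2=1\}$, with the measure $\sigma^{n-1}_{\{\alpha_i\}}$ that is the push-forward of the normalized surface measure of the unit sphere of $\mathbb R^n$ under $x\mapsto(\alpha_1x_1,\dots,\alpha_nx_n)$; both sets carry the restricted Euclidean distance. Let $H$ be the Hilbert space of square-summable real sequences, in which $\mathbb R^n$ is embedded by $x\mapsto(x_1,\dots,x_n,0,0,\dots)$; let $\gamma^\infty_{\{a_i^2\}}=\bigotimes_{i\ge1}\gamma^1_{a_i^2}$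 be the product of the centered Gaussian measures of variance $a_i^2$ on $\mathbb R$ (the Dirac measure at $0$ if $a_i=0$), which is a Borel probability measure on $H$, and let $\Gamma^\infty_{\{a_i^2\}}=(H,\|\cdot\|,\gamma^\infty_{\{a_i^2\}})$. A parameter of a complete separable metric space $X$ with a Borel probability measure $\mu_X$ is a Borel map $[0,1)\to X$ pushing Lebesgue measure $\mathcal L^1$ to $\mu_X$. The box distance of $X$ and $Y$ is the infimum of the $\varepsilon\ge0$ for which there are parameters $\varphi$ of $X$ and $\psi$ of $Y$ and a Borel set $J\subset[0,1)$ with $\mathcal L^1(J)\ge1-\varepsilon$ and $|d_X(\varphi(s),\varphi(t))-d_Y(\psi(s),\psi(t))|\le\varepsilon$ for all $s,t\in J$. Then, as $j\to\infty$: 1. $\epsilon^{n(j)}_{\{\sqrt{n(j)-1}\,a_{ij}\}_i}$ converges weakly to $\gamma^\infty_{\{a_i^2\}}$, as Borel probability measures on $H$; 2. $\sigma^{n(j)-1}_{\{\sqrt{n(j)-1}\,a_{ij}\}_i}$ converges to $\gamma^\infty_{\{a_i^2\}}$ in the $2$-Wasserstein distance on $H$. In particular, both $\mathcal E^{n(j)}_{\{\sqrt{n(j)-1}\,a_{ij}\}_i}$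 and $\mathcal S^{n(j)-1}_{\{\sqrt{n(j)-1}\,a_{ij}\}_i}$ converge in the box distance to $\Gamma^\infty_{\{a_i^2\}}$. -/

import Mathlib

open MeasureTheory ProbabilityTheory Filter Topology Set
open scoped ENNReal NNReal

noncomputable section

/-! ### Wasserstein distance -/

/-- `π` is a coupling of `μ` and `ν`. -/
def IsCoupling {X : Type*} [MeasurableSpace X] (π : Measure (X × X)) (μ ν : Measure X) : Prop :=
  π.map Prod.fst = μ ∧ π.map Prod.snd = ν

/-- The `p`-Wasserstein distance, with values in `[0, ∞]`. -/
def wasserstein {X : Type*} [MetricSpace X] [MeasurableSpace X] (p : ℝ) (μ ν : Measure X) : ℝ≥0∞ :=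
  ⨅ (π : Measure (X × X)) (_ : IsCoupling π μ ν), (∫⁻ z, edist z.1 z.2 ^ p ∂π) ^ (1 / p)

/-! ### Metric measure spaces and the box distance -/

/-- An mm-space: a complete separable metric space with a Borel probability measure. The measure
is not required to have full support; the box distance below does not see the complement of the
support. -/
structure MMSpace where
  carrier : Type
  [metricSpace : MetricSpace carrier]
  [completeSpace : CompleteSpace carrier]
  [separableSpace : TopologicalSpace.SeparableSpace carrier]
  [measurableSpace : MeasurableSpace carrier]
  [borelSpace : BorelSpace carrier]
  measure : Measure carrier
  [isProbabilityMeasure : IsProbabilityMeasure measure]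

attribute [instance] MMSpace.metricSpace MMSpace.completeSpace MMSpace.separableSpace
  MMSpace.measurableSpace MMSpace.borelSpace MMSpace.isProbabilityMeasure

/-- One-dimensional Lebesgue measure on `[0, 1)`. -/
def lebesgueIco : Measure (Ico (0 : ℝ) 1) := (volume : Measure ℝ).comap Subtype.val

/-- A parameter of `X`: a Borel map `[0, 1) → X` pushing Lebesgue measure to the measure of `X`. -/
def MMSpace.IsParameter (X : MMSpace) (φ : Ico (0 : ℝ) 1 → X.carrier) : Prop :=
  Measurable φ ∧ lebesgueIco.map φ = X.measure

/-- The defining condition for `ε` in the box distance of `X` and `Y`. -/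
def BoxClose (X Y : MMSpace) (ε : ℝ≥0) : Prop :=
  ∃ (φ : Ico (0 : ℝ) 1 → X.carrier) (ψ : Ico (0 : ℝ) 1 → Y.carrier) (J : Set (Ico (0 : ℝ) 1)),
    X.IsParameter φ ∧ Y.IsParameter ψ ∧ MeasurableSet J ∧
    1 - (ε : ℝ≥0∞) ≤ lebesgueIco J ∧
    ∀ s ∈ J, ∀ t ∈ J, |dist (φ s) (φ t) - dist (ψ s) (ψ t)| ≤ ε

/-- The box distance; the infimum is taken in `[0, ∞]`. -/
def boxDist (X Y : MMSpace) : ℝ≥0∞ :=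
  ⨅ (ε : ℝ≥0) (_ : BoxClose X Y ε), (ε : ℝ≥0∞)

/-- The sequence of mm-spaces `X j` box converges to `Y`. -/
def BoxConverges (X : ℕ → MMSpace) (Y : MMSpace) : Prop :=
  Tendsto (fun j => boxDist (X j) Y) atTop (𝓝 0)

/-- A closed subset `S` of a complete separable metric space, with the restricted distance and with
(the restriction to `S` of) a probability measure `μ` that is carried by `S`. -/
def MMSpace.ofClosed {X : Type} [MetricSpace X] [CompleteSpace X] [SecondCountableTopology X]
    [MeasurableSpace X] [BorelSpace X] (S : Set X) (hS : IsClosed S)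
    (μ : ProbabilityMeasure X) (hμ : (μ : Measure X) Sᶜ = 0) : MMSpace where
  carrier := S
  completeSpace := hS.completeSpace_coe
  measure := (μ : Measure X).comap Subtype.val
  isProbabilityMeasure := by
    refine ⟨?_⟩
    rw [comap_subtype_coe_apply hS.measurableSet, image_univ, Subtype.range_coe]
    exact (prob_compl_eq_zero_iff hS.measurableSet).1 hμ

/-! ### Ellipsoids -/

/-- The solid ellipsoid with semi-axes `α i`. -/
def solidEllipsoid {n : ℕ} (α : Fin n → ℝ) : Set (EuclideanSpace ℝ (Fin n)) :=
  {x | ∑ i, x i ^ 2 / α i ^ 2 ≤ 1}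

/-- The ellipsoid (hypersurface) with semi-axes `α i`. -/
def surfaceEllipsoid {n : ℕ} (α : Fin n → ℝ) : Set (EuclideanSpace ℝ (Fin n)) :=
  {x | ∑ i, x i ^ 2 / α i ^ 2 = 1}

/-- The linear map `x ↦ (α₁ x₁, …, αₙ xₙ)`. -/
def axisScaling {n : ℕ} (α : Fin n → ℝ) (x : EuclideanSpace ℝ (Fin n)) :
    EuclideanSpace ℝ (Fin n) :=
  WithLp.toLp 2 (fun i => α i * x i)

/-- Normalized Lebesgue measure on the solid ellipsoid, as a Borel measure on `ℝⁿ`. -/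
def solidMeasure {n : ℕ} (α : Fin n → ℝ) : Measure (EuclideanSpace ℝ (Fin n)) :=
  (volume (solidEllipsoid α))⁻¹ • volume.restrict (solidEllipsoid α)

/-- The normalized volume (surface) measure on the unit sphere of `ℝⁿ`. -/
def unitSphereMeasure (n : ℕ) : Measure (Metric.sphere (0 : EuclideanSpace ℝ (Fin n)) 1) :=
  ((volume : Measure (EuclideanSpace ℝ (Fin n))).toSphere univ)⁻¹ •
    (volume : Measure (EuclideanSpace ℝ (Fin n))).toSphere

/-- The measure of the ellipsoid: the push-forward of the normalized volume measure of the unit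
sphere under the linear map `axisScaling α`, as a Borel measure on `ℝⁿ`. -/
def surfaceMeasure {n : ℕ} (α : Fin n → ℝ) : Measure (EuclideanSpace ℝ (Fin n)) :=
  (unitSphereMeasure n).map (fun x : Metric.sphere (0 : EuclideanSpace ℝ (Fin n)) 1 =>
    axisScaling α (x : EuclideanSpace ℝ (Fin n)))

theorem continuous_ellipsoidForm {n : ℕ} (α : Fin n → ℝ) :
    Continuous (fun x : EuclideanSpace ℝ (Fin n) => ∑ i, x i ^ 2 / α i ^ 2) := by
  fun_prop

theorem isClosed_solidEllipsoid {n : ℕ} (α : Fin n → ℝ) : IsClosed (solidEllipsoid α) :=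
  isClosed_le (continuous_ellipsoidForm α) continuous_const

theorem isClosed_surfaceEllipsoid {n : ℕ} (α : Fin n → ℝ) : IsClosed (surfaceEllipsoid α) :=
  isClosed_eq (continuous_ellipsoidForm α) continuous_const

theorem continuous_axisScaling {n : ℕ} (α : Fin n → ℝ) : Continuous (axisScaling α) := by
  unfold axisScaling
  fun_prop

theorem volume_solidEllipsoid_ne_zero {n : ℕ} (α : Fin n → ℝ) :
    volume (solidEllipsoid α) ≠ 0 := by
  have ho : IsOpen {x : EuclideanSpace ℝ (Fin n) | ∑ i, x i ^ 2 / α i ^ 2 < 1} :=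
    isOpen_lt (continuous_ellipsoidForm α) continuous_const
  have hne : ({x : EuclideanSpace ℝ (Fin n) | ∑ i, x i ^ 2 / α i ^ 2 < 1}).Nonempty :=
    ⟨0, by simp⟩
  have h := ho.measure_pos volume hne
  refine (h.trans_le (measure_mono fun x hx => ?_)).ne'
  exact le_of_lt (show ∑ i, x i ^ 2 / α i ^ 2 < 1 from hx)

theorem volume_solidEllipsoid_ne_top {n : ℕ} (α : Fin n → ℝ) (hα : ∀ i, 0 < α i) :
    volume (solidEllipsoid α) ≠ ∞ := by
  have hb : Bornology.IsBounded (solidEllipsoid α) := by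
    refine (Metric.isBounded_closedBall (x := (0 : EuclideanSpace ℝ (Fin n)))
      (r := √(∑ i, α i ^ 2))).subset fun x hx => ?_
    rw [mem_closedBall_zero_iff, EuclideanSpace.norm_eq]
    refine Real.sqrt_le_sqrt (Finset.sum_le_sum fun i _ => ?_)
    have h1 : x i ^ 2 / α i ^ 2 ≤ 1 :=
      (Finset.single_le_sum (f := fun i => x i ^ 2 / α i ^ 2)
        (fun j _ => by positivity) (Finset.mem_univ i)).trans hx
    have h2 : (0 : ℝ) < α i ^ 2 := pow_pos (hα i) 2
    rw [Real.norm_eq_abs, sq_abs]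
    rwa [div_le_one h2] at h1
  exact hb.measure_lt_top.ne

/-- `solidMeasure` as a probability measure. -/
def solidProb {n : ℕ} (α : Fin n → ℝ) (hα : ∀ i, 0 < α i) :
    ProbabilityMeasure (EuclideanSpace ℝ (Fin n)) :=
  ⟨solidMeasure α, ⟨by
    rw [solidMeasure, Measure.smul_apply, Measure.restrict_apply_univ, smul_eq_mul]
    exact ENNReal.inv_mul_cancel (volume_solidEllipsoid_ne_zero α)
      (volume_solidEllipsoid_ne_top α hα)⟩⟩

theorem isProbabilityMeasure_unitSphereMeasure {n : ℕ} (hn : 0 < n) :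
    IsProbabilityMeasure (unitSphereMeasure n) := by
  have : Nonempty (Fin n) := ⟨⟨0, hn⟩⟩
  refine ⟨?_⟩
  rw [unitSphereMeasure, Measure.smul_apply, smul_eq_mul]
  refine ENNReal.inv_mul_cancel ?_ (measure_ne_top _ _)
  rw [Ne, Measure.measure_univ_eq_zero]
  exact Measure.toSphere_ne_zero _

/-- `surfaceMeasure` as a probability measure. -/
def surfaceProb {n : ℕ} (α : Fin n → ℝ) (hn : 0 < n) :
    ProbabilityMeasure (EuclideanSpace ℝ (Fin n)) :=
  ⟨surfaceMeasure α, by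
    have := isProbabilityMeasure_unitSphereMeasure hn
    exact Measure.isProbabilityMeasure_map
      ((continuous_axisScaling α).comp continuous_subtype_val).measurable.aemeasurable⟩

theorem axisScaling_mem_surfaceEllipsoid {n : ℕ} (α : Fin n → ℝ) (hα : ∀ i, 0 < α i)
    (x : Metric.sphere (0 : EuclideanSpace ℝ (Fin n)) 1) :
    axisScaling α (x : EuclideanSpace ℝ (Fin n)) ∈ surfaceEllipsoid α := by
  have h : ‖(x : EuclideanSpace ℝ (Fin n))‖ ^ 2 = 1 := by
    rw [mem_sphere_zero_iff_norm.1 x.2, one_pow]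
  rw [EuclideanSpace.norm_sq_eq] at h
  show ∑ i, (α i * (x : EuclideanSpace ℝ (Fin n)) i) ^ 2 / α i ^ 2 = 1
  refine Eq.trans ?_ h
  refine Finset.sum_congr rfl fun i _ => ?_
  have := (hα i).ne'
  rw [Real.norm_eq_abs, sq_abs]
  field_simp

/-- The solid ellipsoid as an mm-space. -/
def solidSpace {n : ℕ} (α : Fin n → ℝ) (hα : ∀ i, 0 < α i) : MMSpace :=
  MMSpace.ofClosed (solidEllipsoid α) (isClosed_solidEllipsoid α) (solidProb α hα) (by
    show solidMeasure α (solidEllipsoid α)ᶜ = 0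
    rw [solidMeasure, Measure.smul_apply,
      Measure.restrict_apply (isClosed_solidEllipsoid α).measurableSet.compl]
    simp)

/-- The ellipsoid (hypersurface) as an mm-space. -/
def surfaceSpace {n : ℕ} (α : Fin n → ℝ) (hα : ∀ i, 0 < α i) (hn : 0 < n) : MMSpace :=
  MMSpace.ofClosed (surfaceEllipsoid α) (isClosed_surfaceEllipsoid α) (surfaceProb α hn) (by
    show surfaceMeasure α (surfaceEllipsoid α)ᶜ = 0
    have hm : Measurable fun x : Metric.sphere (0 : EuclideanSpace ℝ (Fin n)) 1 =>
        axisScaling α (x : EuclideanSpace ℝ (Fin n)) :=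
      ((continuous_axisScaling α).comp continuous_subtype_val).measurable
    rw [surfaceMeasure, Measure.map_apply hm (isClosed_surfaceEllipsoid α).measurableSet.compl]
    refine measure_mono_null (fun x hx => ?_) (measure_empty (μ := unitSphereMeasure n))
    exact (hx (axisScaling_mem_surfaceEllipsoid α hα x)).elim)

/-! ### The Hilbert space of square-summable sequences and its Gaussian measures -/

/-- The real Hilbert space of square-summable sequences. -/
abbrev HilbertSeq : Type := lp (fun _ : ℕ => ℝ) 2

instance : MeasurableSpace HilbertSeq := borel _

instance : BorelSpace HilbertSeq := ⟨rfl⟩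

instance : TopologicalSpace.SeparableSpace HilbertSeq := by
  have hs : TopologicalSpace.IsSeparable
      (closure (Submodule.span ℝ (range fun i : ℕ => (lp.single 2 i (1 : ℝ) : HilbertSeq)) :
        Set HilbertSeq)) :=
    ((countable_range _).isSeparable.span (R := ℝ)).closure
  refine TopologicalSpace.isSeparable_univ_iff.1 (hs.mono fun x _ => ?_)
  have hx : HasSum (fun i : ℕ => (lp.single 2 i (x i) : HilbertSeq)) x :=
    lp.hasSum_single ENNReal.ofNat_ne_top x
  refine mem_closure_of_tendsto hx (Eventually.of_forall fun s => ?_)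
  refine Submodule.sum_mem _ fun i _ => ?_
  have : (lp.single 2 i (x i) : HilbertSeq) = x i • lp.single 2 i (1 : ℝ) := by
    rw [← lp.single_smul]
    simp
  rw [this]
  exact Submodule.smul_mem _ _ (Submodule.subset_span ⟨i, rfl⟩)

instance : SecondCountableTopology HilbertSeq :=
  UniformSpace.secondCountable_of_separable _

/-- The natural embedding `(x₁, …, xₙ) ↦ (x₁, …, xₙ, 0, 0, …)` of `ℝⁿ`. -/
def embed (n : ℕ) (x : EuclideanSpace ℝ (Fin n)) : HilbertSeq :=
  ∑ i : Fin n, lp.single 2 (i : ℕ) (x i)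

theorem continuous_embed (n : ℕ) : Continuous (embed n) := by
  unfold embed
  refine continuous_finsetSum _ fun i _ => ?_
  exact (lp.isometry_single (E := fun _ : ℕ => ℝ) (p := 2) (i : ℕ)).continuous.comp
    (by fun_prop)

/-- A probability measure on `ℝⁿ` viewed as a probability measure on the Hilbert space. -/
def embedProb {n : ℕ} (μ : ProbabilityMeasure (EuclideanSpace ℝ (Fin n))) :
    ProbabilityMeasure HilbertSeq :=
  μ.map (continuous_embed n).measurable.aemeasurable

/-- The infinite product, on `ℝ^∞`, of the centered Gaussian measures of variance `a i ^ 2`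
(the Dirac measure at `0` if `a i = 0`). -/
def gaussianProduct (a : ℕ → ℝ) : Measure (ℕ → ℝ) :=
  Measure.infinitePi fun i => gaussianReal 0 (Real.toNNReal (a i ^ 2))

/-- The measure `gaussianProduct a` regarded as a Borel measure on the Hilbert space. -/
def gaussianMeasure (a : ℕ → ℝ) : Measure HilbertSeq :=
  (gaussianProduct a).comap fun x : HilbertSeq => (x : ℕ → ℝ)

theorem measurableEmbedding_coe : MeasurableEmbedding fun x : HilbertSeq => (x : ℕ → ℝ) := by
  have hc : Continuous fun x : HilbertSeq => (x : ℕ → ℝ) :=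
    (lp.uniformContinuous_coe (E := fun _ : ℕ => ℝ) (p := 2)).continuous
  exact hc.measurableEmbedding fun x y h => lp.ext h

theorem gaussianProduct_ae_mem (a : ℕ → ℝ) (ha : Summable fun i => a i ^ 2) :
    ∀ᵐ x ∂gaussianProduct a, Memℓp x 2 := by
  have hm : ∀ i : ℕ, Measurable fun x : ℕ → ℝ => ENNReal.ofReal (x i ^ 2) := fun i => by fun_prop
  have h1 : ∀ i : ℕ, ∫⁻ x, ENNReal.ofReal (x i ^ 2) ∂gaussianProduct a
      = ENNReal.ofReal (a i ^ 2) := by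
    intro i
    have hmap := Measure.infinitePi_map_eval
      (fun i => gaussianReal 0 (Real.toNNReal (a i ^ 2))) i
    have h2 : ∫⁻ x, ENNReal.ofReal (x i ^ 2) ∂gaussianProduct a
        = ∫⁻ t, ENNReal.ofReal (t ^ 2) ∂gaussianReal 0 (Real.toNNReal (a i ^ 2)) := by
      rw [← hmap, lintegral_map (by fun_prop) (measurable_pi_apply i)]
      rfl
    have hL := memLp_id_gaussianReal (μ := 0) (v := Real.toNNReal (a i ^ 2)) 2
    have hv := variance_fun_id_gaussianReal (μ := 0) (v := Real.toNNReal (a i ^ 2))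
    rw [variance_of_integral_eq_zero (by fun_prop) (by simp)] at hv
    rw [h2, ← ofReal_integral_eq_lintegral_ofReal (by simpa using hL.integrable_sq)
      (Eventually.of_forall fun t => sq_nonneg t), hv, Real.coe_toNNReal _ (sq_nonneg _)]
  have h3 : ∫⁻ x, ∑' i, ENNReal.ofReal (x i ^ 2) ∂gaussianProduct a ≠ ∞ := by
    rw [lintegral_tsum fun i => (hm i).aemeasurable]
    simp_rw [h1]
    rw [← ENNReal.ofReal_tsum_of_nonneg (fun i => sq_nonneg _) ha]
    exact ENNReal.ofReal_ne_top
  filter_upwards [ae_lt_top (Measurable.tsum hm) h3] with x hx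
  refine memℓp_gen ?_
  have h4 := ENNReal.summable_toReal hx.ne
  refine h4.congr fun i => ?_
  rw [ENNReal.toReal_ofReal (sq_nonneg _)]
  simp

/-- `gaussianMeasure` as a probability measure, for square-summable `a`. -/
def gaussianProb (a : ℕ → ℝ) (ha : Summable fun i => a i ^ 2) : ProbabilityMeasure HilbertSeq :=
  ⟨gaussianMeasure a, ⟨by
    have : IsProbabilityMeasure (gaussianProduct a) := by unfold gaussianProduct; infer_instance
    rw [gaussianMeasure, measurableEmbedding_coe.comap_apply, image_univ]
    have h : ∀ᵐ x ∂gaussianProduct a, x ∈ range fun x : HilbertSeq => (x : ℕ → ℝ) := by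
      filter_upwards [gaussianProduct_ae_mem a ha] with x hx
      exact ⟨⟨x, hx⟩, rfl⟩
    exact (prob_compl_eq_zero_iff measurableEmbedding_coe.measurableSet_range).1 h⟩⟩

/-- The infinite-dimensional Gaussian space with variances `a i ^ 2`, as an mm-space. -/
def gaussianSpace (a : ℕ → ℝ) (ha : Summable fun i => a i ^ 2) : MMSpace where
  carrier := HilbertSeq
  measure := (gaussianProb a ha : Measure HilbertSeq)

/-- The semi-axes `√(n - 1) · b i`. -/
def semiAxes {n : ℕ} (b : Fin n → ℝ) : Fin n → ℝ := fun i => √((n : ℝ) - 1) * b i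

theorem semiAxes_pos {n : ℕ} (hn : 2 ≤ n) {b : Fin n → ℝ} (hb : ∀ i, 0 < b i) (i : Fin n) :
    0 < semiAxes b i := by
  have h : (2 : ℝ) ≤ n := by exact_mod_cast hn
  exact mul_pos (Real.sqrt_pos.2 (by linarith)) (hb i)

end

noncomputable section

/-! ### Polar coordinates -/

/-! Everything is realized on one probability space. Let g be a sequence of independent standard
Gaussians, x its first n coordinates and c = √(n-1)/‖x‖. The direction of x is uniform on the
sphere, so the point X with coordinates b_i x_i c has the law of the ellipsoid surface
(`map_ellipsoidPoint`). The sequence G = (a_i g_i) is almost surely square-summable and has the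
limiting Gaussian law (`exists_hilbertSeq_gaussian`). The mean of ‖X - G‖² bounds the squared
Wasserstein distance.

Coordinatewise, b_i x_i c - a_i x_i = (b_i - a_i) x_i c + a_i x_i (c - 1). Exchangeability turns
E[x_i² h(‖x‖)] into E[‖x‖² h(‖x‖)]/n. Hence E[x_i² c²] ≤ 1, while E[x_i² (c - 1)²] ≤ E[(√(n-1) -
‖x‖)²]/n = O(1/n), because the norm of a Gaussian vector fluctuates by O(1) around √(n-1)
(`lintegral_sqrt_sub_norm_stdGaussian`). Summation over i bounds the cost by 2 Σ(b_i - a_i)², a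
multiple of Σa_i²/n and the tail of Σa_i² (`lintegral_edist_ellipsoidPoint_le`); all three tend to
0.

A uniform point of the solid ellipsoid is rX with an independent radius r concentrating at 1, so the
solid measures also converge in the Wasserstein distance (`tendsto_wasserstein_solid`). This implies
weak convergence, by testing on bounded Lipschitz functions, and box convergence, by applying
Markov's inequality to a coupling parametrized by [0, 1) (`boxClose_of_wasserstein_lt`). -/

theorem eq_inv_smul_of_eq_smul {X : Type*} [MeasurableSpace X] {μ ν : Measure X}
    [IsProbabilityMeasure μ] {c : ℝ≥0∞} (h : μ = c • ν) : μ = (ν univ)⁻¹ • ν := by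
  have h1 : c * ν univ = 1 := by
    rw [← smul_eq_mul, ← Measure.smul_apply, ← h, measure_univ]
  rw [← ENNReal.eq_inv_of_mul_eq_one_left h1, ← h]

/-- The polar parametrization `(θ, r) ↦ r θ`. -/
def polarMap (n : ℕ) (p : Metric.sphere (0 : EuclideanSpace ℝ (Fin n)) 1 × Ioi (0 : ℝ)) :
    EuclideanSpace ℝ (Fin n) := (p.2 : ℝ) • (p.1 : EuclideanSpace ℝ (Fin n))

theorem measurable_polarMap (n : ℕ) : Measurable (polarMap n) := by
  have : Continuous (polarMap n) := by unfold polarMap; fun_prop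
  exact this.measurable

theorem norm_polarMap {n : ℕ}
    (p : Metric.sphere (0 : EuclideanSpace ℝ (Fin n)) 1 × Ioi (0 : ℝ)) :
    ‖polarMap n p‖ = p.2 := by
  have h : (0 : ℝ) < p.2 := p.2.2
  rw [polarMap, norm_smul, mem_sphere_zero_iff_norm.1 p.1.2, mul_one, Real.norm_of_nonneg h.le]

/-- The polar homeomorphism lives on the complement of the origin, which is a null set in positive
dimension. -/
theorem map_polarMap {n : ℕ} (hn : 0 < n) :
    ((volume : Measure (EuclideanSpace ℝ (Fin n))).toSphere.prod
      (Measure.volumeIoiPow (n - 1))).map (polarMap n) = volume := by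
  have : Nonempty (Fin n) := ⟨⟨0, hn⟩⟩
  have h := (volume : Measure (EuclideanSpace ℝ (Fin n))).measurePreserving_homeomorphUnitSphereProd
  have h1 := (MeasurePreserving.symm
    (homeomorphUnitSphereProd (EuclideanSpace ℝ (Fin n))).toMeasurableEquiv h).map_eq
  rw [finrank_euclideanSpace_fin] at h1
  have h2 : polarMap n = Subtype.val ∘
      (homeomorphUnitSphereProd (EuclideanSpace ℝ (Fin n))).toMeasurableEquiv.symm := by
    ext p
    rfl
  rw [h2, ← Measure.map_map measurable_subtype_coe (MeasurableEquiv.measurable _), h1,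
    (MeasurableEmbedding.subtype_coe (measurableSet_singleton _).compl).map_comap,
    Subtype.range_coe, restrict_compl_singleton]

theorem lintegral_polarMap {n : ℕ} (hn : 0 < n) {F : EuclideanSpace ℝ (Fin n) → ℝ≥0∞}
    (hF : Measurable F) :
    ∫⁻ x, F x = ∫⁻ p, F (polarMap n p) ∂((volume : Measure (EuclideanSpace ℝ (Fin n))).toSphere.prod
      (Measure.volumeIoiPow (n - 1))) := by
  rw [← lintegral_map hF (measurable_polarMap n), map_polarMap hn]

/-! ### Gaussian vectors have uniformly distributed directions -/

theorem pi_gaussianReal_eq_withDensity (n : ℕ) :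
    Measure.pi (fun _ : Fin n => gaussianReal 0 1) =
      (volume : Measure (Fin n → ℝ)).withDensity
        fun x => ENNReal.ofReal (∏ i, gaussianPDFReal 0 1 (x i)) := by
  refine Measure.pi_eq fun s hs => ?_
  have hint : ∀ i, Integrable ((s i).indicator (gaussianPDFReal 0 1)) :=
    fun i => (integrable_gaussianPDFReal 0 1).indicator (hs i)
  have hind : ∀ x : Fin n → ℝ, (univ.pi s).indicator
      (fun x => ENNReal.ofReal (∏ i, gaussianPDFReal 0 1 (x i))) x =
      ENNReal.ofReal (∏ i, (s i).indicator (gaussianPDFReal 0 1) (x i)) := by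
    intro x
    by_cases hx : x ∈ univ.pi s
    · rw [indicator_of_mem hx]
      congr 1
      exact Finset.prod_congr rfl fun i _ => (indicator_of_mem (hx i (mem_univ i)) _).symm
    · rw [indicator_of_notMem hx]
      simp only [Set.mem_pi, mem_univ, true_imp_iff, not_forall] at hx
      obtain ⟨i, hi⟩ := hx
      rw [Finset.prod_eq_zero (Finset.mem_univ i) (indicator_of_notMem hi _), ENNReal.ofReal_zero]
  have hnn : ∀ i y, 0 ≤ (s i).indicator (gaussianPDFReal 0 1) y := fun i y =>
    indicator_nonneg (fun z _ => gaussianPDFReal_nonneg 0 1 z) y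
  rw [withDensity_apply _ (MeasurableSet.univ_pi hs),
    ← lintegral_indicator (MeasurableSet.univ_pi hs)]
  simp_rw [hind]
  rw [← ofReal_integral_eq_lintegral_ofReal (by rw [volume_pi]; exact .fintype_prod hint)
    (Eventually.of_forall fun x => Finset.prod_nonneg fun i _ => hnn i _),
    integral_fintype_prod_volume_eq_prod, ENNReal.ofReal_prod_of_nonneg
      (fun i _ => integral_nonneg (hnn i))]
  refine Finset.prod_congr rfl fun i _ => ?_
  rw [gaussianReal_apply_eq_integral 0 one_ne_zero, integral_indicator (hs i)]

/-- Only the radial symmetry of the density is needed later, so its formula stays hidden behind the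
existential. -/
theorem stdGaussian_eq_withDensity (n : ℕ) : ∃ f : ℝ → ℝ≥0∞, Measurable f ∧
    stdGaussian (EuclideanSpace ℝ (Fin n)) =
      (volume : Measure (EuclideanSpace ℝ (Fin n))).withDensity fun x => f ‖x‖ := by
  refine ⟨fun r => ENNReal.ofReal ((√(2 * Real.pi))⁻¹ ^ n * Real.exp (-r ^ 2 / 2)),
    by fun_prop, ?_⟩
  have hdens : ∀ x : Fin n → ℝ, ENNReal.ofReal (∏ i, gaussianPDFReal 0 1 (x i)) =
      ENNReal.ofReal ((√(2 * Real.pi))⁻¹ ^ n * Real.exp (-‖WithLp.toLp 2 x‖ ^ 2 / 2)) := by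
    intro x
    congr 1
    simp only [gaussianPDFReal, Finset.prod_mul_distrib, ← Real.exp_sum, Finset.prod_const,
      Finset.card_univ, Fintype.card_fin, EuclideanSpace.norm_sq_eq]
    simp [← Finset.sum_div]
  rw [← map_pi_eq_stdGaussian, pi_gaussianReal_eq_withDensity]
  simp_rw [hdens]
  ext s hs
  have hme : MeasurableEmbedding (WithLp.toLp 2 : (Fin n → ℝ) → EuclideanSpace ℝ (Fin n)) :=
    (MeasurableEquiv.toLp 2 (Fin n → ℝ)).measurableEmbedding
  rw [hme.map_apply, withDensity_apply _ (hme.measurable hs), withDensity_apply _ hs,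
    ← (PiLp.volume_preserving_toLp (Fin n)).setLIntegral_comp_preimage hs (by fun_prop)]

/-- In polar coordinates a radial density separates from the direction, so the law of the direction
is a multiple of the sphere measure. Total mass 1 fixes the multiple, and the radial integral is
never evaluated. -/
theorem map_direction_stdGaussian {n : ℕ} (hn : 0 < n) :
    (stdGaussian (EuclideanSpace ℝ (Fin n))).map (fun x => ‖x‖⁻¹ • x) =
      (unitSphereMeasure n).map Subtype.val := by
  obtain ⟨f, hf, hd⟩ := stdGaussian_eq_withDensity n
  have hdir : Measurable fun x : EuclideanSpace ℝ (Fin n) => ‖x‖⁻¹ • x := by fun_prop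
  have : IsProbabilityMeasure ((stdGaussian (EuclideanSpace ℝ (Fin n))).map
      (fun x => ‖x‖⁻¹ • x)) := Measure.isProbabilityMeasure_map hdir.aemeasurable
  have key : (stdGaussian (EuclideanSpace ℝ (Fin n))).map (fun x => ‖x‖⁻¹ • x) =
      (∫⁻ r : Ioi (0 : ℝ), f r ∂Measure.volumeIoiPow (n - 1)) •
        (volume : Measure (EuclideanSpace ℝ (Fin n))).toSphere.map Subtype.val := by
    ext s hs
    rw [Measure.map_apply hdir hs, hd, withDensity_apply _ (hdir hs),
      ← lintegral_indicator (hdir hs),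
      lintegral_polarMap hn (Measurable.indicator (by fun_prop) (hdir hs)),
      Measure.smul_apply, Measure.map_apply measurable_subtype_coe hs, smul_eq_mul,
      mul_comm, ← lintegral_indicator_one (measurable_subtype_coe hs),
      ← lintegral_prod_mul (by exact (measurable_one.indicator
        (measurable_subtype_coe hs)).aemeasurable) (by fun_prop)]
    refine lintegral_congr fun p => ?_
    have hp : (0 : ℝ) < p.2 := p.2.2
    have h1 : ‖polarMap n p‖⁻¹ • polarMap n p = (p.1 : EuclideanSpace ℝ (Fin n)) := by
      rw [norm_polarMap, polarMap, smul_smul, inv_mul_cancel₀ hp.ne', one_smul]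
    have h2 : polarMap n p ∈ (fun x => ‖x‖⁻¹ • x) ⁻¹' s ↔
        p.1 ∈ (Subtype.val ⁻¹' s : Set (Metric.sphere (0 : EuclideanSpace ℝ (Fin n)) 1)) := by
      rw [mem_preimage, mem_preimage, h1]
    simp only [indicator, norm_polarMap]
    split_ifs with h3 h4 h4
    · simp
    · exact absurd (h2.1 h3) h4
    · exact absurd (h2.2 h4) h3
    · simp
  rw [eq_inv_smul_of_eq_smul key, unitSphereMeasure, Measure.map_smul,
    Measure.map_apply measurable_subtype_coe .univ, preimage_univ]

/-! ### The solid ellipsoid in polar coordinates -/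

/-- The law of the radius of a uniformly distributed point of the unit ball of `ℝⁿ`. -/
def radialLaw (n : ℕ) : Measure (Ioi (0 : ℝ)) :=
  (Measure.volumeIoiPow (n - 1) (Iic ⟨1, mem_Ioi.2 one_pos⟩))⁻¹ •
    (Measure.volumeIoiPow (n - 1)).restrict (Iic ⟨1, mem_Ioi.2 one_pos⟩)

/-- The open interval (0, 1) already has mass 1/n. A lower bound is enough, since this mass enters
estimates only through its inverse. -/
theorem inv_natCast_le_volumeIoiPow {n : ℕ} (hn : 0 < n) :
    (n : ℝ≥0∞)⁻¹ ≤ Measure.volumeIoiPow (n - 1) (Iic ⟨1, mem_Ioi.2 one_pos⟩) := by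
  refine le_trans (le_of_eq ?_) (measure_mono Iio_subset_Iic_self)
  rw [Measure.volumeIoiPow_apply_Iio, Nat.cast_pred hn]
  simp only [one_pow, sub_add_cancel, one_div]
  rw [ENNReal.ofReal_inv_of_pos (by exact_mod_cast hn), ENNReal.ofReal_natCast]

theorem isProbabilityMeasure_radialLaw {n : ℕ} (hn : 0 < n) :
    IsProbabilityMeasure (radialLaw n) := by
  refine ⟨?_⟩
  rw [radialLaw, Measure.smul_apply, Measure.restrict_apply_univ, smul_eq_mul]
  refine ENNReal.inv_mul_cancel (fun h => ?_) ?_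
  · have := inv_natCast_le_volumeIoiPow hn
    rw [h, nonpos_iff_eq_zero, ENNReal.inv_eq_zero] at this
    exact ENNReal.natCast_ne_top n this
  · refine ((measure_mono (t := Iio ⟨2, mem_Ioi.2 two_pos⟩) fun x hx => ?_).trans_lt ?_).ne
    · exact lt_of_le_of_lt (mem_Iic.1 hx) (Subtype.mk_lt_mk.2 one_lt_two)
    · rw [Measure.volumeIoiPow_apply_Iio]
      exact ENNReal.ofReal_lt_top

theorem radialLaw_Iio_le {n : ℕ} (hn : 0 < n) (x : Ioi (0 : ℝ)) :
    radialLaw n (Iio x) ≤ ENNReal.ofReal ((x : ℝ) ^ n) := by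
  have hx : (0 : ℝ) < x := x.2
  rw [radialLaw, Measure.smul_apply, smul_eq_mul]
  calc _ ≤ ((n : ℝ≥0∞)⁻¹)⁻¹ * Measure.volumeIoiPow (n - 1) (Iio x) :=
        mul_le_mul' (ENNReal.inv_le_inv.2 (inv_natCast_le_volumeIoiPow hn))
          (Measure.restrict_apply_le _ _)
    _ = ENNReal.ofReal ((x : ℝ) ^ n) := by
        rw [Measure.volumeIoiPow_apply_Iio, Nat.cast_pred hn, sub_add_cancel,
          Nat.sub_add_cancel hn, inv_inv, ← ENNReal.ofReal_natCast,
          ← ENNReal.ofReal_mul (by positivity), mul_div_cancel₀ _ (by positivity)]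

theorem ae_radialLaw_le_one (n : ℕ) : ∀ᵐ r : Ioi (0 : ℝ) ∂radialLaw n, (r : ℝ) ≤ 1 := by
  refine Measure.ae_smul_measure ?_ _
  filter_upwards [ae_restrict_mem measurableSet_Iic] with r hr using hr

/-- The mean squared distance of a uniformly distributed point of the unit ball to the sphere. -/
theorem lintegral_radialLaw_le {n : ℕ} (hn : 0 < n) {δ : ℝ} (hδ : 0 < δ) (hδ1 : δ < 1) :
    ∫⁻ r : Ioi (0 : ℝ), ENNReal.ofReal ((1 - (r : ℝ)) ^ 2) ∂radialLaw n ≤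
      ENNReal.ofReal (δ ^ 2) + ENNReal.ofReal ((1 - δ) ^ n) := by
  have := isProbabilityMeasure_radialLaw hn
  let y : Ioi (0 : ℝ) := ⟨1 - δ, sub_pos.2 hδ1⟩
  -- Split at radius 1 - δ: beyond it the integrand is at most δ², below it at most 1, on an event
  -- of probability at most (1 - δ)^n.
  calc _ ≤ ∫⁻ r, (ENNReal.ofReal (δ ^ 2) + (Iio y).indicator 1 r) ∂radialLaw n := by
        refine lintegral_mono_ae ?_
        filter_upwards [ae_radialLaw_le_one n] with r hr
        have hr0 : (0 : ℝ) < r := r.2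
        by_cases h : r ∈ Iio y
        · rw [indicator_of_mem h]
          refine le_add_left (ENNReal.ofReal_le_one.2 ?_)
          nlinarith
        · rw [indicator_of_notMem h, add_zero]
          refine ENNReal.ofReal_le_ofReal ?_
          have : 1 - δ ≤ (r : ℝ) := by simpa [y, ← Subtype.coe_le_coe] using h
          nlinarith
    _ = ENNReal.ofReal (δ ^ 2) + radialLaw n (Iio y) := by
        rw [lintegral_add_left (by fun_prop), lintegral_const, measure_univ, mul_one,
          lintegral_indicator_one measurableSet_Iio]
    _ ≤ _ := by
        gcongr
        exact radialLaw_Iio_le hn y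

theorem tendsto_lintegral_radialLaw :
    Tendsto (fun n => ∫⁻ r : Ioi (0 : ℝ), ENNReal.ofReal ((1 - (r : ℝ)) ^ 2) ∂radialLaw n) atTop (𝓝 0) := by
  rw [ENNReal.tendsto_nhds_zero]
  intro ε hε
  obtain ⟨δ, hδ, hδε⟩ : ∃ δ : ℝ, (0 < δ ∧ δ < 1) ∧ ENNReal.ofReal (δ ^ 2) < ε / 2 := by
    have hc : Tendsto (fun δ : ℝ => ENNReal.ofReal (δ ^ 2)) (𝓝[>] 0) (𝓝 0) := by
      have : Continuous fun δ : ℝ => ENNReal.ofReal (δ ^ 2) :=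
        ENNReal.continuous_ofReal.comp (by fun_prop)
      simpa using (this.tendsto 0).mono_left nhdsWithin_le_nhds
    have h1 := hc.eventually_lt_const (ENNReal.half_pos hε.ne')
    have h2 : ∀ᶠ δ : ℝ in 𝓝[>] 0, 0 < δ ∧ δ < 1 := Ioo_mem_nhdsGT one_pos
    exact (h2.and h1).exists
  have hp : Tendsto (fun n : ℕ => ENNReal.ofReal ((1 - δ) ^ n)) atTop (𝓝 0) := by
    rw [← ENNReal.ofReal_zero]
    exact ENNReal.tendsto_ofReal
      (tendsto_pow_atTop_nhds_zero_of_lt_one (by linarith [hδ.2]) (by linarith [hδ.1]))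
  filter_upwards [hp.eventually_lt_const (ENNReal.half_pos hε.ne'), eventually_gt_atTop 0]
    with n h1 h2
  calc _ ≤ _ := lintegral_radialLaw_le h2 hδ.1 hδ.2
    _ ≤ ε / 2 + ε / 2 := by gcongr
    _ = ε := ENNReal.add_halves ε

theorem map_axisScaling_volume {n : ℕ} (α : Fin n → ℝ) (hα : ∀ i, 0 < α i) :
    ∃ c : ℝ≥0∞, (volume : Measure (EuclideanSpace ℝ (Fin n))).map (axisScaling α) =
      c • volume := by
  let T : EuclideanSpace ℝ (Fin n) →ₗ[ℝ] EuclideanSpace ℝ (Fin n) :=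
    { toFun := axisScaling α
      map_add' := fun x y => by ext i; simp [axisScaling, mul_add]
      map_smul' := fun c x => by ext i; simp [axisScaling, mul_left_comm] }
  have hT : LinearMap.det T ≠ 0 := by
    rw [← isUnit_iff_ne_zero, ← LinearMap.isUnit_iff_isUnit_det, LinearMap.isUnit_iff_ker_eq_bot,
      LinearMap.ker_eq_bot']
    intro x hx
    ext i
    have : α i * x i = 0 := congrArg (fun y : EuclideanSpace ℝ (Fin n) => y i) hx
    simpa [(hα i).ne'] using this
  exact ⟨_, Measure.map_linearMap_addHaar_eq_smul_addHaar volume hT⟩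

theorem axisScaling_mem_solidEllipsoid_iff {n : ℕ} {α : Fin n → ℝ} (hα : ∀ i, 0 < α i)
    (x : EuclideanSpace ℝ (Fin n)) : axisScaling α x ∈ solidEllipsoid α ↔ ‖x‖ ≤ 1 := by
  rw [← sq_le_one_iff₀ (norm_nonneg x), EuclideanSpace.norm_sq_eq]
  refine iff_of_eq (congrArg (· ≤ (1 : ℝ)) (Finset.sum_congr rfl fun i _ => ?_))
  have := (hα i).ne'
  simp only [axisScaling, Real.norm_eq_abs, sq_abs]
  field_simp

/-- Both sides are probability measures proportional to Lebesgue measure on the ellipsoid: radii up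
to 1 correspond exactly to points mapped into it, and the linear scaling multiplies volume by a
constant. Normalization absorbs that constant, so no determinant is computed. -/
theorem solidMeasure_eq_map {n : ℕ} (hn : 0 < n) {α : Fin n → ℝ} (hα : ∀ i, 0 < α i) :
    solidMeasure α =
      ((unitSphereMeasure n).prod (radialLaw n)).map (axisScaling α ∘ polarMap n) := by
  have := isProbabilityMeasure_unitSphereMeasure hn
  have := isProbabilityMeasure_radialLaw hn
  have hm := (continuous_axisScaling α).measurable.comp (measurable_polarMap n)
  have := Measure.isProbabilityMeasure_map (μ := (unitSphereMeasure n).prod (radialLaw n))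
    hm.aemeasurable
  obtain ⟨c, hc⟩ := map_axisScaling_volume α hα
  have hpre : (axisScaling α ∘ polarMap n) ⁻¹' solidEllipsoid α = univ ×ˢ Iic ⟨1, mem_Ioi.2 one_pos⟩ := by
    ext p
    rw [mem_preimage, Function.comp_apply, axisScaling_mem_solidEllipsoid_iff hα, norm_polarMap]
    simp [← Subtype.coe_le_coe]
  have hmap : ((volume : Measure (EuclideanSpace ℝ (Fin n))).toSphere.prod
      ((Measure.volumeIoiPow (n - 1)).restrict (Iic ⟨1, mem_Ioi.2 one_pos⟩))).map
        (axisScaling α ∘ polarMap n) = c • volume.restrict (solidEllipsoid α) := by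
    rw [← Measure.restrict_smul, ← hc]
    conv_rhs => rw [← map_polarMap hn]
    rw [Measure.map_map (continuous_axisScaling α).measurable (measurable_polarMap n),
      Measure.restrict_map hm (isClosed_solidEllipsoid α).measurableSet, hpre,
      ← Measure.prod_restrict, Measure.restrict_univ]
  have hprod : (unitSphereMeasure n).prod (radialLaw n) =
      (((volume : Measure (EuclideanSpace ℝ (Fin n))).toSphere univ)⁻¹ *
        (Measure.volumeIoiPow (n - 1) (Iic ⟨1, mem_Ioi.2 one_pos⟩))⁻¹) •
      (volume : Measure (EuclideanSpace ℝ (Fin n))).toSphere.prod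
      ((Measure.volumeIoiPow (n - 1)).restrict (Iic ⟨1, mem_Ioi.2 one_pos⟩)) := by
    have hS : SFinite ((Measure.volumeIoiPow (n - 1) (Iic ⟨1, mem_Ioi.2 one_pos⟩))⁻¹ •
      (Measure.volumeIoiPow (n - 1)).restrict (Iic ⟨1, mem_Ioi.2 one_pos⟩)) := inferInstance
    rw [unitSphereMeasure, radialLaw, Measure.prod_smul_left, Measure.prod_smul_right, smul_smul]
  have h : ((unitSphereMeasure n).prod (radialLaw n)).map (axisScaling α ∘ polarMap n) =
      ((((volume : Measure (EuclideanSpace ℝ (Fin n))).toSphere univ)⁻¹ *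
        (Measure.volumeIoiPow (n - 1) (Iic ⟨1, mem_Ioi.2 one_pos⟩))⁻¹) * c) •
        volume.restrict (solidEllipsoid α) := by
    rw [hprod, Measure.map_smul, hmap, smul_smul]
  rw [eq_inv_smul_of_eq_smul h, solidMeasure, Measure.restrict_apply_univ]

/-! ### Consequences of Wasserstein convergence -/

theorem wasserstein_map_le {Ω Z : Type*} [MeasurableSpace Ω] [MetricSpace Z] [MeasurableSpace Z]
    (P : Measure Ω) {X Y : Ω → Z} (hX : Measurable X) (hY : Measurable Y) :
    wasserstein 2 (P.map X) (P.map Y) ≤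
      (∫⁻ ω, edist (X ω) (Y ω) ^ (2 : ℝ) ∂P) ^ (1 / 2 : ℝ) := by
  have hXY : Measurable fun ω => (X ω, Y ω) := hX.prodMk hY
  have hc : IsCoupling (P.map fun ω => (X ω, Y ω)) (P.map X) (P.map Y) :=
    ⟨Measure.map_map measurable_fst hXY, Measure.map_map measurable_snd hXY⟩
  -- The inequality suffices here and needs no measurability of the distance on the product.
  have h := lintegral_map_le (μ := P) (fun z : Z × Z => edist z.1 z.2 ^ (2 : ℝ))
    fun ω => (X ω, Y ω)
  calc wasserstein 2 (P.map X) (P.map Y)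
      ≤ (∫⁻ z, edist z.1 z.2 ^ (2 : ℝ) ∂P.map fun ω => (X ω, Y ω)) ^ (1 / 2 : ℝ) :=
        (iInf_le _ _).trans (iInf_le _ hc)
    _ ≤ _ := ENNReal.rpow_le_rpow h (by norm_num)

theorem IsCoupling.isProbabilityMeasure {Z : Type*} [MeasurableSpace Z] {μ ν : Measure Z}
    [IsProbabilityMeasure μ] {π : Measure (Z × Z)} (h : IsCoupling π μ ν) :
    IsProbabilityMeasure π := by
  refine ⟨?_⟩
  rw [← preimage_univ (f := Prod.fst), ← Measure.map_apply measurable_fst .univ, h.1, measure_univ]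

/-- For any coupling, the difference of the integrals is at most L times the mean distance, which
Cauchy–Schwarz bounds by the quadratic cost. With L nonzero, multiplication by L commutes with the
infima, even empty ones. -/
theorem edist_integral_le_wasserstein {Z : Type*} [MetricSpace Z] [SecondCountableTopology Z]
    [MeasurableSpace Z] [BorelSpace Z] {μ ν : Measure Z} [IsProbabilityMeasure μ]
    [IsProbabilityMeasure ν] {f : Z → ℝ} {L : ℝ≥0} (hL0 : L ≠ 0)
    (hL : LipschitzWith L f)
    (hμ : Integrable f μ) (hν : Integrable f ν) :
    edist (∫ x, f x ∂μ) (∫ x, f x ∂ν) ≤ L * wasserstein 2 μ ν := by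
  rw [wasserstein, ENNReal.mul_iInf_of_ne (by exact_mod_cast hL0) ENNReal.coe_ne_top]
  refine le_iInf fun π => ?_
  rw [ENNReal.mul_iInf_of_ne (by exact_mod_cast hL0) ENNReal.coe_ne_top]
  refine le_iInf fun hπ => ?_
  have := hπ.isProbabilityMeasure
  have hm : Measurable f := hL.continuous.measurable
  have h1 : Integrable (fun z : Z × Z => f z.1) π := by
    rw [← hπ.1] at hμ
    exact hμ.comp_measurable measurable_fst
  have h2 : Integrable (fun z : Z × Z => f z.2) π := by
    rw [← hπ.2] at hν
    exact hν.comp_measurable measurable_snd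
  have e1 : ∫ x, f x ∂μ = ∫ z, f z.1 ∂π := by
    rw [← hπ.1, integral_map measurable_fst.aemeasurable hm.aestronglyMeasurable]
  have e2 : ∫ x, f x ∂ν = ∫ z, f z.2 ∂π := by
    rw [← hπ.2, integral_map measurable_snd.aemeasurable hm.aestronglyMeasurable]
  have hd : Measurable fun z : Z × Z => edist z.1 z.2 := measurable_fst.edist measurable_snd
  rw [e1, e2, edist_eq_enorm_sub, ← integral_sub h1 h2]
  calc _ ≤ ∫⁻ z, ‖f z.1 - f z.2‖ₑ ∂π := enorm_integral_le_lintegral_enorm _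
    _ ≤ ∫⁻ z, L * edist z.1 z.2 ∂π := by
        refine lintegral_mono fun z => ?_
        rw [← edist_eq_enorm_sub]
        exact hL z.1 z.2
    _ = L * ∫⁻ z, edist z.1 z.2 ∂π := lintegral_const_mul _ hd
    _ ≤ _ := by
        gcongr
        have h := ENNReal.lintegral_mul_le_Lp_mul_Lq π Real.HolderConjugate.two_two
          hd.aemeasurable (aemeasurable_const (b := (1 : ℝ≥0∞)))
        simpa using h

theorem tendsto_of_tendsto_wasserstein {Z : Type*} [MetricSpace Z] [SecondCountableTopology Z]
    [MeasurableSpace Z] [BorelSpace Z] {μ : ℕ → ProbabilityMeasure Z} {ν : ProbabilityMeasure Z}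
    (h : Tendsto (fun j => wasserstein 2 (μ j : Measure Z) (ν : Measure Z)) atTop (𝓝 0)) :
    Tendsto μ atTop (𝓝 ν) := by
  rw [tendsto_iff_forall_lipschitz_integral_tendsto]
  rintro f ⟨C, hC⟩ ⟨L, hL⟩
  have hint : ∀ ρ : ProbabilityMeasure Z, Integrable f (ρ : Measure Z) := by
    intro ρ
    obtain ⟨x₀⟩ : Nonempty Z := nonempty_of_isProbabilityMeasure (ρ : Measure Z)
    refine Integrable.of_bound hL.continuous.measurable.aestronglyMeasurable (|f x₀| + C)
      (Eventually.of_forall fun x => ?_)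
    have h1 := hC x x₀
    have h2 := abs_sub_abs_le_abs_sub (f x) (f x₀)
    rw [Real.dist_eq] at h1
    rw [Real.norm_eq_abs]
    linarith
  rw [tendsto_iff_edist_tendsto_0]
  refine tendsto_of_tendsto_of_tendsto_of_le_of_le tendsto_const_nhds ?_ (fun _ => zero_le)
    -- L + 1 replaces L to guarantee a nonzero Lipschitz constant.
    (fun j => edist_integral_le_wasserstein (L := L + 1) (by positivity)
      (hL.weaken (le_add_of_nonneg_right zero_le_one)) (hint (μ j)) (hint ν))
  simpa using ENNReal.Tendsto.const_mul h (Or.inr (ENNReal.coe_ne_top (r := L + 1)))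

/-! ### Parameters and the box distance -/

theorem exists_parameter {Z : Type*} [MeasurableSpace Z] [StandardBorelSpace Z]
    (μ : Measure Z) [IsProbabilityMeasure μ] :
    ∃ f : Ico (0 : ℝ) 1 → Z, Measurable f ∧ lebesgueIco.map f = μ := by
  have : Nonempty Z := nonempty_of_isProbabilityMeasure μ
  obtain ⟨g, hg, hμ⟩ := μ.exists_measurable_map_eq
  let i : Ico (0 : ℝ) 1 → unitInterval := fun s => ⟨s, Ico_subset_Icc_self s.2⟩
  have hi : Measurable i := measurable_subtype_coe.subtype_mk
  refine ⟨g ∘ i, hg.comp hi, ?_⟩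
  rw [← Measure.map_map hg hi, ← hμ]
  congr 1
  ext s hs
  rw [Measure.map_apply hi hs, lebesgueIco, comap_subtype_coe_apply measurableSet_Ico,
    Measure.Subtype.volume_def, comap_subtype_coe_apply measurableSet_Icc]
  -- Passing from [0, 1] to [0, 1) loses only the endpoint 1, a null set.
  have himg : (Subtype.val '' (i ⁻¹' s)) =
      (Subtype.val '' s) \ {1} := by
    ext x
    constructor
    · rintro ⟨y, hy, rfl⟩
      exact ⟨⟨_, hy, rfl⟩, y.2.2.ne⟩
    · rintro ⟨⟨y, hy, rfl⟩, hx⟩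
      exact ⟨⟨y, y.2.1, lt_of_le_of_ne y.2.2 hx⟩, hy, rfl⟩
  rw [himg, measure_sdiff_null (measure_singleton _)]

/-- The threshold is set for Markov's inequality: a coupling of squared cost below (ε/2)²ε separates
its two components by ε/2 or more only with probability at most ε. Elsewhere each endpoint moves by
at most ε/2, so mutual distances change by at most ε. -/
theorem boxClose_of_wasserstein_lt {X Y : MMSpace} {ι : X.carrier → Y.carrier} (hι : Isometry ι)
    {ε : ℝ≥0} (hε : 0 < ε)
    (h : wasserstein 2 (X.measure.map ι) Y.measure <
      ((ε / 2 : ℝ≥0∞) ^ (2 : ℝ) * ε) ^ (1 / 2 : ℝ)) : BoxClose X Y ε := by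
  have : SecondCountableTopology Y.carrier := UniformSpace.secondCountable_of_separable _
  have hme : MeasurableEmbedding ι := hι.isClosedEmbedding.measurableEmbedding
  have := Measure.isProbabilityMeasure_map (μ := X.measure) hme.measurable.aemeasurable
  have : Nonempty X.carrier := nonempty_of_isProbabilityMeasure X.measure
  -- `g` is a measurable left inverse of `ι`; its values off the range matter only on the null set
  -- `B` below.
  obtain ⟨g, hg, hgι⟩ := hme.exists_measurable_extend measurable_id (fun _ => this)
  obtain ⟨π, hπ⟩ := iInf_lt_iff.1 h
  obtain ⟨hc, hπ⟩ := iInf_lt_iff.1 hπ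
  have := hc.isProbabilityMeasure
  rw [ENNReal.rpow_lt_rpow_iff (by norm_num)] at hπ
  obtain ⟨f, hf, hfπ⟩ := exists_parameter π
  have hf1 : Measurable fun s => (f s).1 := measurable_fst.comp hf
  have hf2 : Measurable fun s => (f s).2 := measurable_snd.comp hf
  have hdist : Measurable fun s => edist (f s).1 (f s).2 ^ (2 : ℝ) :=
    (hf1.edist hf2).pow_const _
  have hlaw1 : lebesgueIco.map (fun s => (f s).1) = X.measure.map ι := by
    rw [← hc.1, ← hfπ, Measure.map_map measurable_fst hf]; rfl
  have hlaw2 : lebesgueIco.map (fun s => (f s).2) = Y.measure := by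
    rw [← hc.2, ← hfπ, Measure.map_map measurable_snd hf]; rfl
  have hleb : lebesgueIco univ = 1 := by
    have := congrArg (fun m => m univ) hfπ
    simpa [Measure.map_apply hf .univ] using this
  have : IsProbabilityMeasure lebesgueIco := ⟨hleb⟩
  let c : ℝ≥0∞ := (ε / 2 : ℝ≥0∞) ^ (2 : ℝ)
  have hε2 : (ε / 2 : ℝ≥0∞) ≠ 0 := (ENNReal.half_pos (by exact_mod_cast hε.ne')).ne'
  have hε2' : (ε / 2 : ℝ≥0∞) ≠ ∞ := ENNReal.div_ne_top ENNReal.coe_ne_top two_ne_zero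
  have hc0 : c ≠ 0 := (ENNReal.rpow_pos (pos_iff_ne_zero.2 hε2) hε2').ne'
  have hct : c ≠ ∞ := ENNReal.rpow_ne_top_of_nonneg (by norm_num) hε2'
  let A : Set (Ico (0 : ℝ) 1) := {s | c ≤ edist (f s).1 (f s).2 ^ (2 : ℝ)}
  let B : Set (Ico (0 : ℝ) 1) := (fun s => (f s).1) ⁻¹' (range ι)ᶜ
  have hA : MeasurableSet A := measurableSet_le measurable_const hdist
  have hB : MeasurableSet B := hf1 hme.measurableSet_range.compl
  have hB0 : lebesgueIco B = 0 := by
    rw [← Measure.map_apply hf1 hme.measurableSet_range.compl, hlaw1,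
      Measure.map_apply hme.measurable hme.measurableSet_range.compl]
    have : ι ⁻¹' (range ι)ᶜ = ∅ := by ext; simp
    rw [this, measure_empty]
  have hAε : lebesgueIco A ≤ ε := by
    refine (meas_ge_le_lintegral_div hdist.aemeasurable hc0 hct).trans ?_
    refine ENNReal.div_le_of_le_mul' ?_
    refine le_trans (le_of_eq ?_) hπ.le
    rw [← hfπ, lintegral_map ((measurable_fst.edist measurable_snd).pow_const _) hf]
  refine ⟨fun s => g (f s).1, fun s => (f s).2, (A ∪ B)ᶜ, ⟨hg.comp hf1, ?_⟩, ⟨hf2, hlaw2⟩,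
    (hA.union hB).compl, ?_, ?_⟩
  · change lebesgueIco.map (g ∘ fun s => (f s).1) = _
    rw [← Measure.map_map hg hf1, hlaw1, Measure.map_map hg hme.measurable, hgι, Measure.map_id]
  · rw [prob_compl_eq_one_sub (hA.union hB)]
    gcongr
    exact (measure_union_le _ _).trans (by rw [hB0, add_zero]; exact hAε)
  · have key : ∀ s ∈ (A ∪ B)ᶜ, dist (f s).1 (f s).2 ≤ ε / 2 ∧ ι (g (f s).1) = (f s).1 := by
      intro s hs
      rw [compl_union] at hs
      constructor
      · have h1 : edist (f s).1 (f s).2 ^ (2 : ℝ) < c := not_le.1 hs.1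
        rw [ENNReal.rpow_lt_rpow_iff (by norm_num), edist_dist] at h1
        have h3 : (ε / 2 : ℝ≥0∞) = ENNReal.ofReal (ε / 2) := by
          rw [ENNReal.ofReal_div_of_pos two_pos, ENNReal.ofReal_coe_nnreal]; simp
        rw [h3] at h1
        exact (ENNReal.ofReal_lt_ofReal_iff'.1 h1).1.le
      · obtain ⟨x, hx⟩ : (f s).1 ∈ range ι := not_not.1 hs.2
        rw [← hx]
        exact congrArg ι (congrFun hgι x)
    intro s hs t ht
    obtain ⟨hs1, hs2⟩ := key s hs
    obtain ⟨ht1, ht2⟩ := key t ht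
    rw [← hι.dist_eq, hs2, ht2]
    have := dist_dist_dist_le (f s).1 (f t).1 (f s).2 (f t).2
    rw [Real.dist_eq] at this
    linarith

theorem boxConverges_of_tendsto_wasserstein {X : ℕ → MMSpace} {Y : MMSpace}
    {ι : ∀ j, (X j).carrier → Y.carrier} (hι : ∀ j, Isometry (ι j))
    (h : Tendsto (fun j => wasserstein 2 ((X j).measure.map (ι j)) Y.measure) atTop (𝓝 0)) :
    BoxConverges X Y := by
  refine ENNReal.tendsto_nhds_zero.2 fun η hη => ?_
  obtain ⟨ε, hε, hεη⟩ := ENNReal.lt_iff_exists_nnreal_btwn.1 hη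
  have hε0 : 0 < ε := by exact_mod_cast hε
  have hε2 : (0 : ℝ≥0∞) < ε / 2 := ENNReal.half_pos hε.ne'
  have hpos : 0 < ((ε / 2 : ℝ≥0∞) ^ (2 : ℝ) * ε) ^ (1 / 2 : ℝ) := by
    have hε2' : (ε / 2 : ℝ≥0∞) ≠ ∞ := ENNReal.div_ne_top ENNReal.coe_ne_top two_ne_zero
    exact ENNReal.rpow_pos (ENNReal.mul_pos (ENNReal.rpow_pos hε2 hε2').ne' hε.ne')
      (ENNReal.mul_ne_top (ENNReal.rpow_ne_top_of_nonneg (by norm_num) hε2') ENNReal.coe_ne_top)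
  filter_upwards [h.eventually_lt_const hpos] with j hj
  exact (iInf₂_le ε (boxClose_of_wasserstein_lt (hι j) hε0 hj)).trans hεη.le

/-! ### The norm of a standard Gaussian vector -/

theorem memLp_sq_gaussianReal : MemLp (fun x : ℝ => x ^ 2) 2 (gaussianReal 0 1) := by
  rw [memLp_two_iff_integrable_sq (by fun_prop)]
  have h := (memLp_id_gaussianReal (μ := 0) (v := 1) 4).integrable_norm_pow (p := 4) (by norm_num)
  refine h.congr (Eventually.of_forall fun x => ?_)
  simp only [id_eq, Real.norm_eq_abs]
  rw [← pow_mul]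
  exact Even.pow_abs (by decide) x

theorem integral_sq_gaussianReal : ∫ x : ℝ, x ^ 2 ∂gaussianReal 0 1 = 1 := by
  have hv := variance_fun_id_gaussianReal (μ := 0) (v := 1)
  rw [variance_of_integral_eq_zero (by fun_prop) (by simp)] at hv
  simpa using hv

/-- The variance of the square of a standard Gaussian variable. -/
def gaussianSqVariance : ℝ≥0∞ := ENNReal.ofReal Var[fun x : ℝ => x ^ 2; gaussianReal 0 1]

/-- The squared norm is a sum of n independent variables of mean 1, so variances add. -/
theorem lintegral_norm_sq_sub_stdGaussian (n : ℕ) :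
    ∫⁻ x, ENNReal.ofReal ((‖x‖ ^ 2 - n) ^ 2) ∂stdGaussian (EuclideanSpace ℝ (Fin n)) =
      n * gaussianSqVariance := by
  have hmem : ∀ i : Fin n, MemLp (fun x : Fin n → ℝ => x i ^ 2) 2
      (Measure.pi fun _ : Fin n => gaussianReal 0 1) := fun i =>
    memLp_sq_gaussianReal.comp_measurePreserving (measurePreserving_eval _ i)
  have hmean : ∫ x, (∑ i : Fin n, fun x : Fin n → ℝ => x i ^ 2) x
      ∂(Measure.pi fun _ : Fin n => gaussianReal 0 1) = n := by
    simp only [Finset.sum_apply]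
    rw [integral_finsetSum _ fun i _ => (hmem i).integrable one_le_two]
    have h1 : ∀ i : Fin n, ∫ x : Fin n → ℝ, x i ^ 2
        ∂(Measure.pi fun _ : Fin n => gaussianReal 0 1) = 1 := by
      intro i
      have h := integral_map (μ := Measure.pi fun _ : Fin n => gaussianReal 0 1)
        (φ := Function.eval i) (measurable_pi_apply i).aemeasurable
        (f := fun x : ℝ => x ^ 2) (by fun_prop)
      rw [(measurePreserving_eval (fun _ : Fin n => gaussianReal 0 1) i).map_eq,
        integral_sq_gaussianReal] at h
      exact h.symm
    simp [h1]
  have hvar := variance_sum_pi (μ := fun _ : Fin n => gaussianReal 0 1)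
    (X := fun _ x => x ^ 2) fun _ => memLp_sq_gaussianReal
  have hev := ofReal_variance (memLp_finsetSum' Finset.univ fun i _ => hmem i)
  rw [hvar, evariance_eq_lintegral_ofReal, hmean] at hev
  rw [← map_pi_eq_stdGaussian, lintegral_map (by fun_prop) (by fun_prop)]
  simp only [EuclideanSpace.norm_sq_eq, Real.norm_eq_abs, sq_abs]
  simp only [Finset.sum_apply] at hev
  rw [← hev, Finset.sum_const, Finset.card_univ, Fintype.card_fin, nsmul_eq_mul,
    ENNReal.ofReal_mul (by positivity), ENNReal.ofReal_natCast, gaussianSqVariance]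

theorem sq_sqrt_sub_le {m t : ℝ} (hm : 1 ≤ m) (ht : 0 ≤ t) :
    (√(m - 1) - t) ^ 2 ≤ 2 + 2 * ((t ^ 2 - m) ^ 2 / m) := by
  have h0 : 0 < m := by linarith
  have hs := Real.sq_sqrt h0.le
  have hs1 := Real.sq_sqrt (sub_nonneg.2 hm)
  have hp := Real.sqrt_nonneg m
  have hp1 := Real.sqrt_nonneg (m - 1)
  have hle : √(m - 1) ≤ √m := Real.sqrt_le_sqrt (by linarith)
  have h1 : (√m - √(m - 1)) ^ 2 ≤ 1 := by nlinarith
  have h2 : (√m - t) ^ 2 ≤ (t ^ 2 - m) ^ 2 / m := by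
    rw [le_div_iff₀ h0]
    have e : (t ^ 2 - m) ^ 2 = (√m - t) ^ 2 * (√m + t) ^ 2 := by
      nth_rewrite 1 [← hs]
      ring
    rw [e]
    refine mul_le_mul_of_nonneg_left ?_ (sq_nonneg _)
    nlinarith [mul_nonneg hp ht]
  -- With u = √m - t and v = √m - √(m-1), the left side is (u - v)² = 2u² + 2v² - (u + v)².
  nlinarith [sq_nonneg ((√m - t) + (√m - √(m - 1)))]

/-- Concentration of the norm: the variance of ‖x‖² grows like n, and dividing by n leaves a bound
independent of the dimension. -/
theorem lintegral_sqrt_sub_norm_stdGaussian {n : ℕ} (hn : 0 < n) :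
    ∫⁻ x, ENNReal.ofReal ((√((n : ℝ) - 1) - ‖x‖) ^ 2)
      ∂stdGaussian (EuclideanSpace ℝ (Fin n)) ≤ 2 + 2 * gaussianSqVariance := by
  have hn' : (0 : ℝ) < n := by exact_mod_cast hn
  calc _ ≤ ∫⁻ x, (2 + 2 * (n : ℝ≥0∞)⁻¹ * ENNReal.ofReal ((‖x‖ ^ 2 - n) ^ 2))
        ∂stdGaussian (EuclideanSpace ℝ (Fin n)) := by
        refine lintegral_mono fun x => ?_
        refine (ENNReal.ofReal_le_ofReal
          (sq_sqrt_sub_le (m := n) (by exact_mod_cast hn) (norm_nonneg x))).trans (le_of_eq ?_)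
        rw [ENNReal.ofReal_add zero_le_two (by positivity), ENNReal.ofReal_mul zero_le_two,
          ENNReal.ofReal_div_of_pos hn', ENNReal.ofReal_natCast, ENNReal.ofReal_ofNat,
          ENNReal.div_eq_inv_mul, mul_assoc]
    _ = 2 + 2 * (n : ℝ≥0∞)⁻¹ * (n * gaussianSqVariance) := by
        rw [lintegral_add_left measurable_const, lintegral_const, measure_univ, mul_one,
          lintegral_const_mul _ (by fun_prop), lintegral_norm_sq_sub_stdGaussian]
    _ = 2 + 2 * gaussianSqVariance := by
        rw [mul_assoc, ← mul_assoc (n : ℝ≥0∞)⁻¹, ENNReal.inv_mul_cancel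
          (by exact_mod_cast hn.ne') (ENNReal.natCast_ne_top n), one_mul]

/-! ### Exchangeability of the coordinates -/

/-- Swapping two coordinates is a linear isometry, so it preserves both the Gaussian law and the
norm. -/
theorem lintegral_sq_mul_norm_stdGaussian_congr {n : ℕ} {h : ℝ → ℝ≥0∞} (hh : Measurable h)
    (i k : Fin n) :
    ∫⁻ x, ENNReal.ofReal (x i ^ 2) * h ‖x‖ ∂stdGaussian (EuclideanSpace ℝ (Fin n)) =
      ∫⁻ x, ENNReal.ofReal (x k ^ 2) * h ‖x‖ ∂stdGaussian (EuclideanSpace ℝ (Fin n)) := by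
  let e := LinearIsometryEquiv.piLpCongrLeft 2 ℝ ℝ (Equiv.swap i k)
  conv_lhs => rw [← stdGaussian_map e]
  rw [lintegral_map (by fun_prop) e.continuous.measurable]
  refine lintegral_congr fun x => ?_
  have h1 : e x i = x k := by
    simp [e, LinearIsometryEquiv.piLpCongrLeft_apply, Equiv.piCongrLeft'_apply]
  rw [e.norm_map, h1]

theorem card_mul_lintegral_sq_mul_norm_stdGaussian {n : ℕ} {h : ℝ → ℝ≥0∞} (hh : Measurable h)
    (i : Fin n) :
    n * ∫⁻ x, ENNReal.ofReal (x i ^ 2) * h ‖x‖ ∂stdGaussian (EuclideanSpace ℝ (Fin n)) =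
      ∫⁻ x, ENNReal.ofReal (‖x‖ ^ 2) * h ‖x‖ ∂stdGaussian (EuclideanSpace ℝ (Fin n)) := by
  have hx : ∀ x : EuclideanSpace ℝ (Fin n), ENNReal.ofReal (‖x‖ ^ 2) * h ‖x‖ =
      ∑ k, ENNReal.ofReal (x k ^ 2) * h ‖x‖ := by
    intro x
    rw [← Finset.sum_mul, ← ENNReal.ofReal_sum_of_nonneg fun k _ => sq_nonneg _,
      EuclideanSpace.norm_sq_eq]
    simp
  simp_rw [hx]
  rw [lintegral_finsetSum _ fun k _ => by fun_prop,
    Finset.sum_congr rfl fun k _ => lintegral_sq_mul_norm_stdGaussian_congr hh k i]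
  simp

theorem lintegral_sq_mul_norm_stdGaussian_le {n : ℕ} {h : ℝ → ℝ} (hh : Measurable h)
    (i : Fin n) {B : ℝ≥0∞}
    (hB : ∫⁻ x, ENNReal.ofReal (‖x‖ ^ 2 * h ‖x‖) ∂stdGaussian (EuclideanSpace ℝ (Fin n)) ≤ B) :
    ∫⁻ x, ENNReal.ofReal (x i ^ 2 * h ‖x‖) ∂stdGaussian (EuclideanSpace ℝ (Fin n)) ≤ B / n := by
  have hn : 0 < n := i.pos
  rw [ENNReal.le_div_iff_mul_le (.inl (by exact_mod_cast hn.ne')) (.inl (ENNReal.natCast_ne_top n)),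
    mul_comm]
  refine le_trans (le_of_eq ?_) hB
  simp_rw [ENNReal.ofReal_mul (sq_nonneg _)]
  exact card_mul_lintegral_sq_mul_norm_stdGaussian (h := fun t => ENNReal.ofReal (h t))
    (by fun_prop) i

theorem lintegral_normalized_coord_le {n : ℕ} (i : Fin n) :
    ∫⁻ x, ENNReal.ofReal (x i ^ 2 * (√((n : ℝ) - 1) * ‖x‖⁻¹) ^ 2)
      ∂stdGaussian (EuclideanSpace ℝ (Fin n)) ≤ 1 := by
  have hn : 0 < n := i.pos
  have hn1 : (1 : ℝ) ≤ n := by exact_mod_cast hn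
  have hB : ∫⁻ x, ENNReal.ofReal (‖x‖ ^ 2 * (√((n : ℝ) - 1) * ‖x‖⁻¹) ^ 2)
      ∂stdGaussian (EuclideanSpace ℝ (Fin n)) ≤ n := by
    calc _ ≤ ∫⁻ _, (n : ℝ≥0∞) ∂stdGaussian (EuclideanSpace ℝ (Fin n)) := by
          refine lintegral_mono fun x => ?_
          rw [← ENNReal.ofReal_natCast n]
          refine ENNReal.ofReal_le_ofReal ?_
          rw [mul_pow, Real.sq_sqrt (by linarith)]
          rcases eq_or_ne ‖x‖ 0 with h | h
          · simp [h]
          · field_simp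
            linarith
      _ = n := by simp
  refine (lintegral_sq_mul_norm_stdGaussian_le (h := fun t => (√((n : ℝ) - 1) * t⁻¹) ^ 2)
    (by fun_prop) i hB).trans ENNReal.div_self_le_one

theorem lintegral_normalized_coord_sub_le {n : ℕ} (i : Fin n) :
    ∫⁻ x, ENNReal.ofReal (x i ^ 2 * (√((n : ℝ) - 1) * ‖x‖⁻¹ - 1) ^ 2)
      ∂stdGaussian (EuclideanSpace ℝ (Fin n)) ≤ (2 + 2 * gaussianSqVariance) / n := by
  refine lintegral_sq_mul_norm_stdGaussian_le (h := fun t => (√((n : ℝ) - 1) * t⁻¹ - 1) ^ 2)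
    (by fun_prop) i (le_trans (lintegral_mono fun x => ?_)
      (lintegral_sqrt_sub_norm_stdGaussian i.pos))
  refine ENNReal.ofReal_le_ofReal ?_
  -- At the origin the left side vanishes; elsewhere the factor ‖x‖ cancels the inverse and the two
  -- sides agree.
  rcases eq_or_ne ‖x‖ 0 with h | h
  · simp only [h]
    nlinarith [sq_nonneg (√((n : ℝ) - 1))]
  · refine le_of_eq ?_
    field_simp

/-! ### The Hilbert space of square-summable sequences -/

theorem edist_hilbertSeq_sq (x y : HilbertSeq) :
    edist x y ^ (2 : ℝ) = ∑' i, ENNReal.ofReal ((x i - y i) ^ 2) := by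
  have h := lp.hasSum_norm (p := 2) (by norm_num) (x - y)
  simp only [ENNReal.toReal_ofNat, Real.rpow_two, Real.norm_eq_abs, sq_abs] at h
  have h' : HasSum (fun i => (x i - y i) ^ 2) (‖x - y‖ ^ 2) := h
  rw [← ENNReal.ofReal_tsum_of_nonneg (fun i => sq_nonneg _) h'.summable, h'.tsum_eq, edist_dist,
    dist_eq_norm, ENNReal.ofReal_rpow_of_nonneg (norm_nonneg _) zero_le_two, Real.rpow_two]

theorem embed_apply {n : ℕ} (x : EuclideanSpace ℝ (Fin n)) (k : ℕ) :
    embed n x k = if h : k < n then x ⟨k, h⟩ else 0 := by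
  rw [embed, lp.coeFn_sum, Finset.sum_apply]
  simp only [lp.single_apply]
  split_ifs with h
  · rw [Finset.sum_eq_single ⟨k, h⟩]
    · simp
    · intro i _ hi
      exact Pi.single_eq_of_ne (fun hk => hi (Fin.ext hk.symm)) _
    · simp
  · exact Finset.sum_eq_zero fun i _ => Pi.single_eq_of_ne (fun hk => h (hk.trans_lt i.2)) _

theorem edist_embed_sq {n : ℕ} (x : EuclideanSpace ℝ (Fin n)) (y : HilbertSeq) :
    edist (embed n x) y ^ (2 : ℝ) = ∑ i : Fin n, ENNReal.ofReal ((x i - y i) ^ 2) +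
      ∑' k, ENNReal.ofReal (y (k + n) ^ 2) := by
  rw [edist_hilbertSeq_sq, ← ENNReal.summable.sum_add_tsum_nat_add' (k := n), Finset.sum_range]
  congr 1
  · refine Finset.sum_congr rfl fun i _ => ?_
    rw [embed_apply, dif_pos i.2]
  · refine tsum_congr fun k => ?_
    rw [embed_apply, dif_neg (by omega), zero_sub, neg_sq]

theorem isometry_embed (n : ℕ) : Isometry (embed n) := by
  intro x y
  have h : edist (embed n x) (embed n y) ^ (2 : ℝ) = edist x y ^ (2 : ℝ) := by
    rw [edist_embed_sq, edist_dist, EuclideanSpace.dist_eq,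
      ENNReal.ofReal_rpow_of_nonneg (Real.sqrt_nonneg _) zero_le_two, Real.rpow_two,
      Real.sq_sqrt (by positivity), ENNReal.ofReal_sum_of_nonneg fun i _ => sq_nonneg _]
    have h0 : ∑' k, ENNReal.ofReal (embed n y (k + n) ^ 2) = 0 := by
      refine ENNReal.tsum_eq_zero.2 fun k => ?_
      rw [embed_apply, dif_neg (by omega)]
      simp
    rw [h0, add_zero]
    refine Finset.sum_congr rfl fun i _ => ?_
    rw [embed_apply, dif_pos i.2, Real.dist_eq, sq_abs]
  exact ENNReal.rpow_left_injective two_ne_zero h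

/-! ### The Gaussian coupling -/

/-- The law of a sequence of independent standard Gaussian variables. -/
def gaussianSeq : Measure (ℕ → ℝ) := Measure.infinitePi fun _ => gaussianReal 0 1

instance : IsProbabilityMeasure gaussianSeq := by unfold gaussianSeq; infer_instance

/-- The first `n` coordinates of a sequence. -/
def firstCoords (n : ℕ) (g : ℕ → ℝ) : EuclideanSpace ℝ (Fin n) := WithLp.toLp 2 fun i => g i

theorem measurable_firstCoords (n : ℕ) : Measurable (firstCoords n) := by
  unfold firstCoords
  fun_prop

theorem map_firstCoords (n : ℕ) :
    gaussianSeq.map (firstCoords n) = stdGaussian (EuclideanSpace ℝ (Fin n)) := by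
  have h1 : gaussianSeq.map (fun g (i : Fin n) => g i) =
      Measure.pi fun _ : Fin n => gaussianReal 0 1 := by
    refine (Measure.pi_eq fun s hs => ?_).symm
    rw [Measure.map_apply (by fun_prop) (MeasurableSet.univ_pi hs), gaussianSeq]
    -- The value `univ` only makes the family total; indices at or above n do not enter this
    -- cylinder.
    have hpre : (fun (g : ℕ → ℝ) (i : Fin n) => g i) ⁻¹' univ.pi s =
        Set.pi (Finset.range n) fun k => if h : k < n then s ⟨k, h⟩ else univ := by
      ext g
      simp only [mem_preimage, Set.mem_pi, mem_univ, true_imp_iff, Finset.coe_range, mem_Iio]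
      constructor
      · intro hg k hk
        rw [dif_pos hk]
        exact hg ⟨k, hk⟩
      · intro hg i
        simpa using hg i i.2
    rw [hpre, Measure.infinitePi_pi, Finset.prod_range]
    · simp
    · intro k _
      split_ifs
      · exact hs _
      · exact .univ
  rw [← map_pi_eq_stdGaussian, ← h1, Measure.map_map (by fun_prop) (by fun_prop)]
  rfl

/-- The scaled sequence is square-summable only almost surely. Composing with a measurable left
inverse `L` of the inclusion gives an everywhere defined Hilbert-valued map. -/
theorem exists_hilbertSeq_gaussian (a : ℕ → ℝ) (ha : Summable fun i => a i ^ 2) :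
    ∃ G : (ℕ → ℝ) → HilbertSeq, Measurable G ∧ gaussianSeq.map G = gaussianMeasure a ∧
      ∀ᵐ g ∂gaussianSeq, ∀ i, G g i = a i * g i := by
  obtain ⟨L, hL, hLid⟩ := measurableEmbedding_coe.exists_measurable_extend measurable_id
    fun _ => ⟨(0 : HilbertSeq)⟩
  have hs : Measurable fun (g : ℕ → ℝ) i => a i * g i := by fun_prop
  have hlaw : gaussianSeq.map (fun g i => a i * g i) = gaussianProduct a := by
    rw [gaussianSeq, Measure.infinitePi_map_pi (f := fun i t => a i * t) _ (by fun_prop),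
      gaussianProduct]
    congr 1
    funext i
    rw [gaussianReal_map_const_mul, mul_zero, mul_one, Real.toNNReal_of_nonneg (sq_nonneg _)]
  have hmem : ∀ᵐ x ∂gaussianProduct a, x ∈ range fun x : HilbertSeq => (x : ℕ → ℝ) := by
    filter_upwards [gaussianProduct_ae_mem a ha] with x hx using ⟨⟨x, hx⟩, rfl⟩
  refine ⟨fun g => L fun i => a i * g i, hL.comp hs, ?_, ?_⟩
  · have : gaussianSeq.map (fun g => L fun i => a i * g i) = (gaussianProduct a).map L := by
      rw [← hlaw, Measure.map_map hL hs]
      rfl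
    rw [this]
    ext s hs
    rw [Measure.map_apply hL hs, gaussianMeasure, measurableEmbedding_coe.comap_apply]
    -- The preimage under `L` and the image under the inclusion can differ only outside the
    -- square-summable sequences.
    refine measure_congr ?_
    filter_upwards [hmem] with x hx
    obtain ⟨y, rfl⟩ := hx
    have hy : L (y : ℕ → ℝ) = y := congrFun hLid y
    refine propext ?_
    change L (y : ℕ → ℝ) ∈ s ↔ (y : ℕ → ℝ) ∈ (fun x : HilbertSeq => (x : ℕ → ℝ)) '' s
    rw [hy]
    exact (measurableEmbedding_coe.injective.mem_set_image (s := s)).symm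
  · rw [← hlaw] at hmem
    filter_upwards [ae_of_ae_map hs.aemeasurable hmem] with g hg i
    obtain ⟨y, hy⟩ := hg
    have hy' : L (y : ℕ → ℝ) = y := congrFun hLid y
    simp only at hy
    rw [← hy, hy', hy]

/-- The random point of the ellipsoid in the direction of a Gaussian vector. -/
def ellipsoidPoint {n : ℕ} (α : Fin n → ℝ) (g : ℕ → ℝ) : EuclideanSpace ℝ (Fin n) :=
  axisScaling α (‖firstCoords n g‖⁻¹ • firstCoords n g)

theorem measurable_direction_firstCoords (n : ℕ) :
    Measurable fun g : ℕ → ℝ => ‖firstCoords n g‖⁻¹ • firstCoords n g := by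
  have := measurable_firstCoords n
  fun_prop

theorem measurable_ellipsoidPoint {n : ℕ} (α : Fin n → ℝ) : Measurable (ellipsoidPoint α) :=
  (continuous_axisScaling α).measurable.comp (measurable_direction_firstCoords n)

theorem map_direction_firstCoords {n : ℕ} (hn : 0 < n) :
    gaussianSeq.map (fun g => ‖firstCoords n g‖⁻¹ • firstCoords n g) =
      (unitSphereMeasure n).map Subtype.val := by
  rw [← map_direction_stdGaussian hn, ← map_firstCoords,
    Measure.map_map (by fun_prop) (measurable_firstCoords n)]
  rfl

theorem map_ellipsoidPoint {n : ℕ} (hn : 0 < n) (α : Fin n → ℝ) :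
    gaussianSeq.map (ellipsoidPoint α) = surfaceMeasure α := by
  have h := Measure.map_map (μ := gaussianSeq) (continuous_axisScaling α).measurable
    (measurable_direction_firstCoords n)
  rw [map_direction_firstCoords hn,
    Measure.map_map (continuous_axisScaling α).measurable measurable_subtype_coe] at h
  exact h.symm

/-- The axis scaling is linear, so the independent radius can be applied after it, and the solid
ellipsoid shares the surface point's Gaussian coupling. -/
theorem map_smul_ellipsoidPoint {n : ℕ} (hn : 0 < n) {α : Fin n → ℝ} (hα : ∀ i, 0 < α i) :
    (gaussianSeq.prod (radialLaw n)).map (fun p => (p.2 : ℝ) • ellipsoidPoint α p.1) =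
      solidMeasure α := by
  have := isProbabilityMeasure_radialLaw hn
  have := isProbabilityMeasure_unitSphereMeasure hn
  let q : EuclideanSpace ℝ (Fin n) × Ioi (0 : ℝ) → EuclideanSpace ℝ (Fin n) :=
    fun p => axisScaling α ((p.2 : ℝ) • p.1)
  have hq : Measurable q := by
    refine (continuous_axisScaling α).measurable.comp ?_
    fun_prop
  have h1 : (fun p : (ℕ → ℝ) × Ioi (0 : ℝ) => (p.2 : ℝ) • ellipsoidPoint α p.1) =
      q ∘ Prod.map (fun g => ‖firstCoords n g‖⁻¹ • firstCoords n g) id := by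
    ext p i
    simp [q, ellipsoidPoint, axisScaling]
    ring
  have h2 : axisScaling α ∘ polarMap n = q ∘ Prod.map Subtype.val id := rfl
  rw [solidMeasure_eq_map hn hα, h1, h2,
    ← Measure.map_map hq ((measurable_direction_firstCoords n).prodMap measurable_id),
    ← Measure.map_map hq (measurable_subtype_coe.prodMap measurable_id),
    ← Measure.map_prod_map _ _ (measurable_direction_firstCoords n) measurable_id,
    ← Measure.map_prod_map _ _ measurable_subtype_coe measurable_id,
    map_direction_firstCoords hn]

/-! ### The cost of the Gaussian coupling -/

theorem ellipsoidPoint_semiAxes_apply {n : ℕ} (b : Fin n → ℝ) (g : ℕ → ℝ) (i : Fin n) :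
    ellipsoidPoint (semiAxes b) g i =
      b i * (firstCoords n g i * (√((n : ℝ) - 1) * ‖firstCoords n g‖⁻¹)) := by
  simp only [ellipsoidPoint, axisScaling, semiAxes, PiLp.smul_apply, smul_eq_mul]
  ring

theorem lintegral_ellipsoidPoint_coord_le {n : ℕ} (b : Fin n → ℝ) (i : Fin n) (t : ℝ) :
    ∫⁻ g, ENNReal.ofReal ((ellipsoidPoint (semiAxes b) g i - t * g i) ^ 2) ∂gaussianSeq ≤
      2 * ENNReal.ofReal ((b i - t) ^ 2) +
        2 * ENNReal.ofReal (t ^ 2) * ((2 + 2 * gaussianSqVariance) / n) := by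
  let F : EuclideanSpace ℝ (Fin n) → ℝ≥0∞ := fun x =>
    2 * ENNReal.ofReal ((b i - t) ^ 2) *
        ENNReal.ofReal (x i ^ 2 * (√((n : ℝ) - 1) * ‖x‖⁻¹) ^ 2) +
      2 * ENNReal.ofReal (t ^ 2) *
        ENNReal.ofReal (x i ^ 2 * (√((n : ℝ) - 1) * ‖x‖⁻¹ - 1) ^ 2)
  have hF : Measurable F := by fun_prop
  calc _ ≤ ∫⁻ g, F (firstCoords n g) ∂gaussianSeq := by
        refine lintegral_mono fun g => ?_
        have hg : g i = firstCoords n g i := rfl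
        rw [ellipsoidPoint_semiAxes_apply, hg]
        generalize firstCoords n g = x
        simp only [F]
        generalize √((n : ℝ) - 1) * ‖x‖⁻¹ = c
        generalize x i = y
        rw [← ENNReal.ofReal_ofNat 2, ← ENNReal.ofReal_mul zero_le_two,
          ← ENNReal.ofReal_mul zero_le_two, ← ENNReal.ofReal_mul (by positivity),
          ← ENNReal.ofReal_mul (by positivity), ← ENNReal.ofReal_add (by positivity)
            (by positivity)]
        refine ENNReal.ofReal_le_ofReal ?_
        -- The error is u + v with u = (b i - t) y c and v = t y (c - 1); the hint is (u - v)² ≥ 0.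
        nlinarith [sq_nonneg ((b i - t) * (y * c) - t * (y * (c - 1)))]
    _ = ∫⁻ x, F x ∂stdGaussian (EuclideanSpace ℝ (Fin n)) := by
        rw [← map_firstCoords, lintegral_map hF (measurable_firstCoords n)]
    _ ≤ 2 * ENNReal.ofReal ((b i - t) ^ 2) * 1 +
        2 * ENNReal.ofReal (t ^ 2) * ((2 + 2 * gaussianSqVariance) / n) := by
        rw [lintegral_add_left (by fun_prop), lintegral_const_mul _ (by fun_prop),
          lintegral_const_mul _ (by fun_prop)]
        gcongr
        · exact lintegral_normalized_coord_le i
        · exact lintegral_normalized_coord_sub_le i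
    _ = _ := by rw [mul_one]

theorem measurable_sq_coord (t : ℝ) (k : ℕ) :
    Measurable fun g : ℕ → ℝ => ENNReal.ofReal ((t * g k) ^ 2) :=
  ((measurable_const.mul (measurable_pi_apply k)).pow_const 2).ennreal_ofReal

theorem lintegral_sq_coord_gaussianSeq (t : ℝ) (k : ℕ) :
    ∫⁻ g, ENNReal.ofReal ((t * g k) ^ 2) ∂gaussianSeq = ENNReal.ofReal (t ^ 2) := by
  simp_rw [mul_pow, ENNReal.ofReal_mul (sq_nonneg t)]
  rw [lintegral_const_mul _ (by fun_prop)]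
  have h := lintegral_map (μ := gaussianSeq) (f := fun x : ℝ => ENNReal.ofReal (x ^ 2))
    (by fun_prop) (measurable_pi_apply k)
  rw [gaussianSeq, Measure.infinitePi_map_eval, ← ofReal_integral_eq_lintegral_ofReal
    (memLp_sq_gaussianReal.integrable one_le_two) (Eventually.of_forall fun x => sq_nonneg x),
    integral_sq_gaussianReal] at h
  rw [gaussianSeq, ← h, ENNReal.ofReal_one, mul_one]

/-- The three terms measure the mismatch of the axes, the fluctuation of the Gaussian norm, and the
coordinates of the limit beyond n, where the embedded point is zero. -/
theorem lintegral_edist_ellipsoidPoint_le {n : ℕ} (b : Fin n → ℝ) {a : ℕ → ℝ}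
    {G : (ℕ → ℝ) → HilbertSeq}
    (hGa : ∀ᵐ g ∂gaussianSeq, ∀ i, G g i = a i * g i) :
    ∫⁻ g, edist (embed n (ellipsoidPoint (semiAxes b) g)) (G g) ^ (2 : ℝ) ∂gaussianSeq ≤
      2 * ENNReal.ofReal (∑ i : Fin n, (b i - a i) ^ 2) +
        2 * (∑' k, ENNReal.ofReal (a k ^ 2)) * ((2 + 2 * gaussianSqVariance) / n) +
        ∑' k, ENNReal.ofReal (a (k + n) ^ 2) := by
  have hm : ∀ i : Fin n, Measurable fun g : ℕ → ℝ =>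
      ENNReal.ofReal ((ellipsoidPoint (semiAxes b) g i - a i * g i) ^ 2) := fun i => by
    have hc : Measurable fun x : EuclideanSpace ℝ (Fin n) => x i := by fun_prop
    exact (((hc.comp (measurable_ellipsoidPoint (semiAxes b))).sub
      (measurable_const.mul (measurable_pi_apply (i : ℕ)))).pow_const 2).ennreal_ofReal
  calc _ = ∫⁻ g, (∑ i : Fin n, ENNReal.ofReal
          ((ellipsoidPoint (semiAxes b) g i - a i * g i) ^ 2) +
        ∑' k, ENNReal.ofReal ((a (k + n) * g (k + n)) ^ 2)) ∂gaussianSeq := by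
        refine lintegral_congr_ae ?_
        filter_upwards [hGa] with g hg
        rw [edist_embed_sq]
        simp_rw [hg]
    _ = ∑ i : Fin n, ∫⁻ g, ENNReal.ofReal
          ((ellipsoidPoint (semiAxes b) g i - a i * g i) ^ 2) ∂gaussianSeq +
        ∑' k, ENNReal.ofReal (a (k + n) ^ 2) := by
        rw [lintegral_add_right _ (Measurable.tsum fun k => measurable_sq_coord _ _),
          lintegral_finsetSum _ fun i _ => hm i, lintegral_tsum fun k => (measurable_sq_coord _ _).aemeasurable]
        simp_rw [lintegral_sq_coord_gaussianSeq]
    _ ≤ _ := by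
        gcongr
        refine (Finset.sum_le_sum fun i _ => lintegral_ellipsoidPoint_coord_le b i (a i)).trans ?_
        rw [Finset.sum_add_distrib, ← Finset.mul_sum, ← Finset.sum_mul, ← Finset.mul_sum,
          ENNReal.ofReal_sum_of_nonneg fun i _ => sq_nonneg _]
        gcongr
        rw [← Finset.sum_range fun k => ENNReal.ofReal (a k ^ 2)]
        exact ENNReal.sum_le_tsum _

theorem gaussianSqVariance_ne_top : gaussianSqVariance ≠ ∞ := ENNReal.ofReal_ne_top

theorem tendsto_lintegral_edist_ellipsoidPoint {n : ℕ → ℕ} (hn : Tendsto n atTop atTop)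
    (b : (j : ℕ) → Fin (n j) → ℝ) {a : ℕ → ℝ} (ha : Summable fun i => a i ^ 2)
    (hab : Tendsto (fun j => ∑ i : Fin (n j), (b j i - a i) ^ 2) atTop (𝓝 0))
    {G : (ℕ → ℝ) → HilbertSeq}
    (hGa : ∀ᵐ g ∂gaussianSeq, ∀ i, G g i = a i * g i) :
    Tendsto (fun j => ∫⁻ g, edist (embed (n j) (ellipsoidPoint (semiAxes (b j)) g)) (G g) ^ (2 : ℝ)
      ∂gaussianSeq) atTop (𝓝 0) := by
  have hfin : ∑' k, ENNReal.ofReal (a k ^ 2) ≠ ∞ := by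
    rw [← ENNReal.ofReal_tsum_of_nonneg (fun i => sq_nonneg _) ha]
    exact ENNReal.ofReal_ne_top
  have h1 : Tendsto (fun j => 2 * ENNReal.ofReal (∑ i : Fin (n j), (b j i - a i) ^ 2)) atTop
      (𝓝 0) := by
    have := ENNReal.Tendsto.const_mul (ENNReal.tendsto_ofReal hab)
      (Or.inr (ENNReal.ofNat_ne_top (n := 2)))
    simpa using this
  have h2 : Tendsto (fun j => 2 * (∑' k, ENNReal.ofReal (a k ^ 2)) *
      ((2 + 2 * gaussianSqVariance) / (n j : ℝ≥0∞))) atTop (𝓝 0) := by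
    have hK : 2 + 2 * gaussianSqVariance ≠ ∞ :=
      ENNReal.add_ne_top.2 ⟨ENNReal.ofNat_ne_top,
        ENNReal.mul_ne_top ENNReal.ofNat_ne_top gaussianSqVariance_ne_top⟩
    have h := ENNReal.Tendsto.const_div (ENNReal.tendsto_nat_nhds_top.comp hn) (Or.inr hK)
    rw [ENNReal.div_top] at h
    simpa using ENNReal.Tendsto.const_mul h
      (Or.inr (ENNReal.mul_ne_top (ENNReal.ofNat_ne_top (n := 2)) hfin))
  have h3 : Tendsto (fun j => ∑' k, ENNReal.ofReal (a (k + n j) ^ 2)) atTop (𝓝 0) :=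
    (ENNReal.tendsto_sum_nat_add (fun k => ENNReal.ofReal (a k ^ 2)) hfin).comp hn
  have h := (h1.add h2).add h3
  simp only [add_zero] at h
  exact tendsto_of_tendsto_of_tendsto_of_le_of_le tendsto_const_nhds h (fun _ => zero_le)
    fun j => lintegral_edist_ellipsoidPoint_le (b j) hGa

/-! ### From the surface to the solid ellipsoid. -/

theorem edist_sq_le_two_mul {Z : Type*} [PseudoEMetricSpace Z] (x y z : Z) :
    edist x z ^ (2 : ℝ) ≤ 2 * (edist x y ^ (2 : ℝ) + edist y z ^ (2 : ℝ)) := by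
  refine (ENNReal.rpow_le_rpow (edist_triangle x y z) zero_le_two).trans ?_
  have h := ENNReal.rpow_add_le_mul_rpow_add_rpow (edist x y) (edist y z) (p := 2) one_le_two
  norm_num at h ⊢
  exact h

theorem lintegral_edist_zero_gaussian {a : ℕ → ℝ} {G : (ℕ → ℝ) → HilbertSeq}
    (hGa : ∀ᵐ g ∂gaussianSeq, ∀ i, G g i = a i * g i) :
    ∫⁻ g, edist (G g) 0 ^ (2 : ℝ) ∂gaussianSeq = ∑' k, ENNReal.ofReal (a k ^ 2) := by
  calc _ = ∫⁻ g, ∑' k, ENNReal.ofReal ((a k * g k) ^ 2) ∂gaussianSeq := by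
        refine lintegral_congr_ae ?_
        filter_upwards [hGa] with g hg
        rw [edist_hilbertSeq_sq]
        refine tsum_congr fun k => ?_
        rw [← hg k]
        simp
    _ = _ := by
        rw [lintegral_tsum fun k => (measurable_sq_coord _ _).aemeasurable]
        simp_rw [lintegral_sq_coord_gaussianSeq]

theorem edist_embed_smul {n : ℕ} (x : EuclideanSpace ℝ (Fin n)) (r : ℝ) :
    edist (embed n (r • x)) (embed n x) ^ (2 : ℝ) =
      edist (embed n x) 0 ^ (2 : ℝ) * ENNReal.ofReal ((1 - r) ^ 2) := by
  have h0 : embed n 0 = 0 := by simp [embed]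
  have h1 : r • x - x = (r - 1) • x := by rw [sub_smul, one_smul]
  rw [← h0, (isometry_embed n).edist_eq, (isometry_embed n).edist_eq, edist_eq_enorm_sub, h1,
    enorm_smul, edist_zero_right, ENNReal.mul_rpow_of_nonneg _ _ zero_le_two, mul_comm,
    Real.enorm_eq_ofReal_abs, ENNReal.ofReal_rpow_of_nonneg (abs_nonneg _) zero_le_two,
    Real.rpow_two, sq_abs, ← neg_sub r 1, neg_sq]

/-- Compare rX with G through X. By independence, the mean of ‖rX - X‖² factors into that of ‖X‖²,
at most 2(D + S), and that of (1 - r)². -/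
theorem lintegral_edist_smul_le {n : ℕ} (hn : 0 < n) {X : (ℕ → ℝ) → EuclideanSpace ℝ (Fin n)}
    (hX : Measurable X) {G : (ℕ → ℝ) → HilbertSeq} (hG : Measurable G) {D S R : ℝ≥0∞}
    (hD : ∫⁻ g, edist (embed n (X g)) (G g) ^ (2 : ℝ) ∂gaussianSeq ≤ D)
    (hS : ∫⁻ g, edist (G g) 0 ^ (2 : ℝ) ∂gaussianSeq ≤ S)
    (hR : ∫⁻ r : Ioi (0 : ℝ), ENNReal.ofReal ((1 - (r : ℝ)) ^ 2) ∂radialLaw n ≤ R) :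
    ∫⁻ p, edist (embed n ((p.2 : ℝ) • X p.1)) (G p.1) ^ (2 : ℝ)
      ∂(gaussianSeq.prod (radialLaw n)) ≤ 2 * (2 * (D + S) * R + D) := by
  have := isProbabilityMeasure_radialLaw hn
  have hE := (continuous_embed n).measurable
  have hXm : Measurable fun g => edist (embed n (X g)) 0 ^ (2 : ℝ) :=
    ((hE.comp hX).edist measurable_const).pow_const _
  have hXG : Measurable fun g => edist (embed n (X g)) (G g) ^ (2 : ℝ) :=
    ((hE.comp hX).edist hG).pow_const _
  have hXS : ∫⁻ g, edist (embed n (X g)) 0 ^ (2 : ℝ) ∂gaussianSeq ≤ 2 * (D + S) := by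
    refine (lintegral_mono fun g => edist_sq_le_two_mul _ (G g) 0).trans ?_
    have hm : Measurable fun g =>
        edist (embed n (X g)) (G g) ^ (2 : ℝ) + edist (G g) 0 ^ (2 : ℝ) :=
      hXG.add ((hG.edist measurable_const).pow_const _)
    rw [lintegral_const_mul _ hm, lintegral_add_left hXG]
    gcongr
  calc _ ≤ ∫⁻ p : (ℕ → ℝ) × Ioi (0 : ℝ), 2 * (edist (embed n (X p.1)) 0 ^ (2 : ℝ) *
          ENNReal.ofReal ((1 - (p.2 : ℝ)) ^ 2) + edist (embed n (X p.1)) (G p.1) ^ (2 : ℝ))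
          ∂(gaussianSeq.prod (radialLaw n)) := by
        refine lintegral_mono fun p => ?_
        simp only
        rw [← edist_embed_smul]
        exact edist_sq_le_two_mul _ _ _
    _ = 2 * ((∫⁻ g, edist (embed n (X g)) 0 ^ (2 : ℝ) ∂gaussianSeq) *
          (∫⁻ r : Ioi (0 : ℝ), ENNReal.ofReal ((1 - (r : ℝ)) ^ 2) ∂radialLaw n) +
          ∫⁻ g, edist (embed n (X g)) (G g) ^ (2 : ℝ) ∂gaussianSeq) := by
        have hm2 : Measurable fun r : Ioi (0 : ℝ) => ENNReal.ofReal ((1 - (r : ℝ)) ^ 2) := by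
          fun_prop
        have hm1 : Measurable fun p : (ℕ → ℝ) × Ioi (0 : ℝ) =>
            edist (embed n (X p.1)) 0 ^ (2 : ℝ) * ENNReal.ofReal ((1 - (p.2 : ℝ)) ^ 2) :=
          (hXm.comp measurable_fst).mul (hm2.comp measurable_snd)
        have hm3 : Measurable fun p : (ℕ → ℝ) × Ioi (0 : ℝ) =>
            edist (embed n (X p.1)) (G p.1) ^ (2 : ℝ) := hXG.comp measurable_fst
        have hm4 : Measurable fun p : (ℕ → ℝ) × Ioi (0 : ℝ) =>
            edist (embed n (X p.1)) 0 ^ (2 : ℝ) * ENNReal.ofReal ((1 - (p.2 : ℝ)) ^ 2) +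
              edist (embed n (X p.1)) (G p.1) ^ (2 : ℝ) := hm1.add hm3
        rw [lintegral_const_mul _ hm4, lintegral_add_left hm1,
          lintegral_prod_mul hXm.aemeasurable hm2.aemeasurable,
          lintegral_prod _ hm3.aemeasurable]
        simp
    _ ≤ _ := by gcongr

/-! ### Convergence in the Wasserstein distance -/

theorem tendsto_rpow_half {u : ℕ → ℝ≥0∞} (hu : Tendsto u atTop (𝓝 0)) :
    Tendsto (fun j => u j ^ (1 / 2 : ℝ)) atTop (𝓝 0) := by
  have h := hu.ennrpow_const (1 / 2 : ℝ)
  rwa [ENNReal.zero_rpow_of_pos (by norm_num)] at h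

theorem tendsto_wasserstein_surface {n : ℕ → ℕ} (hn0 : ∀ j, 0 < n j) (hn : Tendsto n atTop atTop)
    (b : (j : ℕ) → Fin (n j) → ℝ) {a : ℕ → ℝ} (ha : Summable fun i => a i ^ 2)
    (hab : Tendsto (fun j => ∑ i : Fin (n j), (b j i - a i) ^ 2) atTop (𝓝 0)) :
    Tendsto (fun j => wasserstein 2 ((surfaceMeasure (semiAxes (b j))).map (embed (n j)))
      (gaussianMeasure a)) atTop (𝓝 0) := by
  obtain ⟨G, hG, hlaw, hGa⟩ := exists_hilbertSeq_gaussian a ha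
  refine tendsto_of_tendsto_of_tendsto_of_le_of_le tendsto_const_nhds
    (tendsto_rpow_half (tendsto_lintegral_edist_ellipsoidPoint hn b ha hab hGa))
    (fun _ => zero_le) fun j => ?_
  have hX := measurable_ellipsoidPoint (semiAxes (b j))
  have hE := (continuous_embed (n j)).measurable
  rw [← hlaw, ← map_ellipsoidPoint (hn0 j), Measure.map_map hE hX]
  exact wasserstein_map_le gaussianSeq (hE.comp hX) hG

theorem tendsto_wasserstein_solid {n : ℕ → ℕ} (hn0 : ∀ j, 0 < n j) (hn : Tendsto n atTop atTop)
    (b : (j : ℕ) → Fin (n j) → ℝ) (hα : ∀ j i, 0 < semiAxes (b j) i)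
    {a : ℕ → ℝ} (ha : Summable fun i => a i ^ 2)
    (hab : Tendsto (fun j => ∑ i : Fin (n j), (b j i - a i) ^ 2) atTop (𝓝 0)) :
    Tendsto (fun j => wasserstein 2 ((solidMeasure (semiAxes (b j))).map (embed (n j)))
      (gaussianMeasure a)) atTop (𝓝 0) := by
  obtain ⟨G, hG, hlaw, hGa⟩ := exists_hilbertSeq_gaussian a ha
  have hD := tendsto_lintegral_edist_ellipsoidPoint hn b ha hab hGa
  have hR := tendsto_lintegral_radialLaw.comp hn
  have hfin : ∑' k, ENNReal.ofReal (a k ^ 2) ≠ ∞ := by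
    rw [← ENNReal.ofReal_tsum_of_nonneg (fun i => sq_nonneg _) ha]
    exact ENNReal.ofReal_ne_top
  have hDS := hD.add (tendsto_const_nhds (x := ∑' k, ENNReal.ofReal (a k ^ 2)))
  rw [zero_add] at hDS
  have h2DS := ENNReal.Tendsto.const_mul hDS (Or.inr (ENNReal.ofNat_ne_top (n := 2)))
  -- Finiteness of Σa_i² excludes the indeterminate product ∞ · 0.
  have hmul := ENNReal.Tendsto.mul h2DS (Or.inr ENNReal.zero_ne_top) hR
    (Or.inr (ENNReal.mul_ne_top (ENNReal.ofNat_ne_top (n := 2)) hfin))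
  have hsum := ENNReal.Tendsto.const_mul (hmul.add hD) (Or.inr (ENNReal.ofNat_ne_top (n := 2)))
  simp only [mul_zero, add_zero] at hsum
  refine tendsto_of_tendsto_of_tendsto_of_le_of_le tendsto_const_nhds (tendsto_rpow_half hsum)
    (fun _ => zero_le) fun j => ?_
  have := isProbabilityMeasure_radialLaw (hn0 j)
  have hX := measurable_ellipsoidPoint (semiAxes (b j))
  have hE := (continuous_embed (n j)).measurable
  have hY : Measurable fun p : (ℕ → ℝ) × Ioi (0 : ℝ) =>
      (p.2 : ℝ) • ellipsoidPoint (semiAxes (b j)) p.1 := by fun_prop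
  have hfst : (gaussianSeq.prod (radialLaw (n j))).map (fun p => G p.1) = gaussianMeasure a := by
    have h := Measure.map_map (μ := gaussianSeq.prod (radialLaw (n j))) hG measurable_fst
    rw [Measure.map_fst_prod, measure_univ, one_smul, hlaw] at h
    exact h.symm
  rw [← hfst, ← map_smul_ellipsoidPoint (hn0 j) (hα j), Measure.map_map hE hY]
  refine (wasserstein_map_le _ (hE.comp hY) (hG.comp measurable_fst)).trans ?_
  exact ENNReal.rpow_le_rpow (lintegral_edist_smul_le (hn0 j) hX hG le_rfl
    (lintegral_edist_zero_gaussian hGa).le le_rfl) (by norm_num)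

/-! ### Ellipsoids as metric measure spaces, and the theorem. -/

theorem map_comp_val_ofClosed {X Y : Type} [MetricSpace X] [CompleteSpace X]
    [SecondCountableTopology X] [MeasurableSpace X] [BorelSpace X] [MeasurableSpace Y] {S : Set X}
    (hS : IsClosed S) (μ : ProbabilityMeasure X) (hμ : (μ : Measure X) Sᶜ = 0) {f : X → Y}
    (hf : Measurable f) :
    (MMSpace.ofClosed S hS μ hμ).measure.map (fun x : S => f x) = (μ : Measure X).map f := by
  change ((μ : Measure X).comap Subtype.val).map (f ∘ Subtype.val) = _
  rw [← Measure.map_map hf measurable_subtype_coe,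
    (MeasurableEmbedding.subtype_coe hS.measurableSet).map_comap, Subtype.range_coe,
    Measure.restrict_eq_self_of_ae_mem (mem_ae_iff.2 hμ)]

theorem proposition4p2 (n : ℕ → ℕ) (hn2 : ∀ j, 2 ≤ n j) (hn : Tendsto n atTop atTop)
    (b : (j : ℕ) → Fin (n j) → ℝ) (hb : ∀ j i, 0 < b j i)
    (a : ℕ → ℝ) (ha0 : ∀ i, 0 ≤ a i) (ha : Summable fun i => a i ^ 2)
    (hab : Tendsto (fun j => ∑ i : Fin (n j), (b j i - a i) ^ 2) atTop (𝓝 0)) :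
    Tendsto (fun j => embedProb (solidProb (semiAxes (b j)) (semiAxes_pos (hn2 j) (hb j))))
      atTop (𝓝 (gaussianProb a ha)) ∧
    Tendsto (fun j => wasserstein 2
        (embedProb (surfaceProb (semiAxes (b j)) (two_pos.trans_le (hn2 j))) : Measure HilbertSeq)
        (gaussianProb a ha : Measure HilbertSeq))
      atTop (𝓝 0) ∧
    BoxConverges (fun j => solidSpace (semiAxes (b j)) (semiAxes_pos (hn2 j) (hb j)))
      (gaussianSpace a ha) ∧
    BoxConverges (fun j => surfaceSpace (semiAxes (b j)) (semiAxes_pos (hn2 j) (hb j))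
      (two_pos.trans_le (hn2 j))) (gaussianSpace a ha) := by
  have hn0 : ∀ j, 0 < n j := fun j => two_pos.trans_le (hn2 j)
  have hsolid := tendsto_wasserstein_solid hn0 hn b (fun j => semiAxes_pos (hn2 j) (hb j)) ha hab
  have hsurf := tendsto_wasserstein_surface hn0 hn b ha hab
  have hiso : ∀ j, ∀ S : Set (EuclideanSpace ℝ (Fin (n j))),
      Isometry fun x : S => embed (n j) x := fun j S =>
    (isometry_embed (n j)).comp isometry_subtype_coe
  -- Weak convergence of the solid measures comes from their stronger Wasserstein convergence, which
  -- also yields box convergence.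
  refine ⟨tendsto_of_tendsto_wasserstein hsolid, hsurf,
    boxConverges_of_tendsto_wasserstein (fun j => hiso j (solidEllipsoid (semiAxes (b j)))) ?_,
    boxConverges_of_tendsto_wasserstein (fun j => hiso j (surfaceEllipsoid (semiAxes (b j)))) ?_⟩
  · refine hsolid.congr fun j => ?_
    exact congrArg (fun μ => wasserstein 2 μ (gaussianMeasure a))
      (map_comp_val_ofClosed _ (solidProb _ (semiAxes_pos (hn2 j) (hb j))) _
        (continuous_embed (n j)).measurable).symm
  · refine hsurf.congr fun j => ?_
    exact congrArg (fun μ => wasserstein 2 μ (gaussianMeasure a))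
      (map_comp_val_ofClosed _ (surfaceProb _ (hn0 j)) _
        (continuous_embed (n j)).measurable).symm

end
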